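/- **Model.** Let $G_a:\mathbb R\to\mathbb R$, $E:[0,1]\to\mathbb R$, $\mu:[0,1]\to\mathbb R$, $U_0\in\mathbb R$, $\underline w,\overline w\in\mathbb R$ and $c\in(0,1]$. For a wage $w$ and an effort (annotation quality) $\eta\in[0,1]$ the agent's utility is $U_a(w,\eta)=G_a(w)-E(\eta)$ and the principal's utility is $U_p(w,\eta)=-w+\mu(\eta)$. At effort $\eta$ the assessment data $\boldsymbol A=(A_1,\dots,A_n)\in\{0,1\}^n$ are i.i.d. Bernoulli with $\mathbb P_\eta(A_i=1)=\frac{1+c\eta}{2}$; $\mathbb E_\eta$ denotes expectation under this law. A contract is a map $F_n:\{0,1\}^n\to[\underline w,\overline w]$; it is binary if there are a test $\Psi:\{0,1\}^n\to\{0,1\}$, a base salary $w$ and a bonus $w_b$ such that $F_n=w+w_b\Psi$. **Assumptions.** 1. $G_a$ and $E$ are twice continuously differentiable, with $G_a'>0$, $G_a''<0$ on $\mathbb R$ and $E'>0$, $E''\ge 0$ on $[0,1]$. 2. $\mu$ is twice continuously differentiable, with $\mu'\ge0$, $\mu''\le0$ on $[0,1]$. 3. $E([0,1])+U_0\subset\operatorname{interior}\big(G_a([\underline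 w,\overline w])\big)$. 4. The first-best effort satisfies $\eta^*\in(0,1)$. Here $\eta^*$ is the effort at the optimal solution of the first-best program $$\max_{F_n,\ \eta\in[0,1]}\ \mathbb E_\eta[U_p(F_n(\boldsymbol A),\eta)]\quad\text{s.t.}\quad \mathbb E_\eta[U_a(F_n(\boldsymbol A),\eta)]\ge U_0$$ over all contracts $F_n$ (it does not depend on $n$). **Second-best program.** For each $n$, the unrestricted binary second-best program is $$\max_{F_n\ \text{binary},\ \eta\in[0,1]}\ \mathbb E_{\eta}[U_p(F_n(\boldsymbol A),\eta)]\quad\text{s.t.}\quad \mathbb E_{\eta}[U_a(F_n(\boldsymbol A),\eta)]\ge U_0,\qquad \eta\in\operatorname*{arg\,max}_{\eta'\in[0,1]}\mathbb E_{\eta'}[U_a(F_n(\boldsymbol A),\eta')].$$ **Proposition.** Under these assumptions the unrestricted binary second-best program has an optimal solution for every $n$, and whenever $\eta_n^*$ is, for each $n$, the effort at an optimal solution of it, $$(\eta_n^*-\eta^*)^2=\mathcal O\!\left(\frac1{\sqrt{n\log n}}\right)\quad(n\to\infty);$$ in particular $\eta_n^*\to\eta^*$. -/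

import Mathlib

open Set Filter Topology Asymptotics

noncomputable section

/-- The primitives of the principal-agent model for data annotation.  Only the values of
`effort` and `quality` on `[0, 1]` are ever used below. -/
structure AnnotationModel where
  /-- monetary utility `G_a` of the agent (annotator) -/
  money : ℝ → ℝ
  /-- effort (disutility) function `E` of the agent, a function of the quality `η ∈ [0, 1]` -/
  effort : ℝ → ℝ
  /-- utility `μ` of the principal (company) as a function of the quality `η ∈ [0, 1]` -/
  quality : ℝ → ℝ
  /-- leisure utility `U_0` -/
  leisure : ℝ
  /-- lower wage bound -/
  wageLo : ℝ
  /-- upper wage bound -/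
  wageHi : ℝ
  /-- `c = 1 - δ`: an inspected sample passes with probability `(1 + c η) / 2` -/
  c : ℝ

namespace AnnotationModel

variable (M : AnnotationModel)

/-- Utility of the agent, `U_a(w, η) = G_a(w) - E(η)`. -/
def agentUtility (w η : ℝ) : ℝ := M.money w - M.effort η

/-- Utility of the principal, `U_p(w, η) = -w + μ(η)`. -/
def principalUtility (w η : ℝ) : ℝ := -w + M.quality η

/-- `G_a` is twice continuously differentiable with `G_a' > 0` and `G_a'' < 0`, and `E` is twice
continuously differentiable on `[0, 1]` with `E' > 0` and `E'' ≥ 0`. -/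
def AgentAssumption : Prop :=
  ContDiff ℝ 2 M.money ∧
  (∀ w, 0 < deriv M.money w) ∧
  (∀ w, deriv (deriv M.money) w < 0) ∧
  ContDiffOn ℝ 2 M.effort (Icc 0 1) ∧
  (∀ η ∈ Icc (0 : ℝ) 1, 0 < derivWithin M.effort (Icc 0 1) η) ∧
  (∀ η ∈ Icc (0 : ℝ) 1, 0 ≤ derivWithin (derivWithin M.effort (Icc 0 1)) (Icc 0 1) η)

/-- `μ` is twice continuously differentiable on `[0, 1]` with `μ' ≥ 0` and `μ'' ≤ 0`. -/
def PrincipalAssumption : Prop :=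
  ContDiffOn ℝ 2 M.quality (Icc 0 1) ∧
  (∀ η ∈ Icc (0 : ℝ) 1, 0 ≤ derivWithin M.quality (Icc 0 1) η) ∧
  (∀ η ∈ Icc (0 : ℝ) 1, derivWithin (derivWithin M.quality (Icc 0 1)) (Icc 0 1) η ≤ 0)

/-- The wage range covers all the efforts plus the leisure utility:
`E([0, 1]) + U_0 ⊆ interior (G_a([wageLo, wageHi]))`.  (That all wages lie in the wage range is part
of the definition of the contract classes below.) -/
def WageAssumption : Prop :=
  (fun η => M.effort η + M.leisure) '' Icc 0 1 ⊆
    interior (M.money '' Icc M.wageLo M.wageHi)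

/-- Probability that a single inspected sample passes the assessment at quality `η`. -/
def passProb (η : ℝ) : ℝ := (1 + M.c * η) / 2

/-- Assessment data: for each of the `n` inspected samples, whether it passes (`A_i = 1`). -/
abbrev Data (n : ℕ) : Type := Fin n → Bool

/-- Probability of the data `A = a` when the `A_i` are independent Bernoulli variables with success
probability `passProb η`. -/
def dataProb {n : ℕ} (η : ℝ) (a : Data n) : ℝ :=
  ∏ i, if a i then M.passProb η else 1 - M.passProb η

/-- Expectation of `f(A)` at quality `η`. -/
def expect {n : ℕ} (η : ℝ) (f : Data n → ℝ) : ℝ := ∑ a, M.dataProb η a * f a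

/-- A contract maps the assessment data to the wage paid to the agent. -/
abbrev Contract (n : ℕ) : Type := Data n → ℝ

/-- `E[U_a(F(A), η)]`, where `A` is generated at quality `η`. -/
def expAgent {n : ℕ} (F : Contract n) (η : ℝ) : ℝ :=
  M.expect η fun a => M.agentUtility (F a) η

/-- `E[U_p(F(A), η)]`, where `A` is generated at quality `η`. -/
def expPrincipal {n : ℕ} (F : Contract n) (η : ℝ) : ℝ :=
  M.expect η fun a => M.principalUtility (F a) η

/-- All contracts whose wages lie in the wage range. -/
def contracts (n : ℕ) : Set (Contract n) :=
  {F | ∀ a, F a ∈ Icc M.wageLo M.wageHi}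

/-- The binary contracts `(Ψ, w, w_b)` with wages in the wage range: the agent is paid the base
salary `w`, plus the bonus `w_b` if the test `Ψ` is passed. -/
def binaryContracts (n : ℕ) : Set (Contract n) :=
  {F | F ∈ M.contracts n ∧
    ∃ (Ψ : Data n → Bool) (w wb : ℝ), F = fun a => if Ψ a then w + wb else w}

/-- Individual rationality. -/
def IsIR {n : ℕ} (F : Contract n) (η : ℝ) : Prop := M.leisure ≤ M.expAgent F η

/-- Incentive compatibility: `η` maximizes the expected utility of the agent over `[0, 1]`. -/
def IsIC {n : ℕ} (F : Contract n) (η : ℝ) : Prop :=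
  η ∈ Icc (0 : ℝ) 1 ∧ IsMaxOn (M.expAgent F) (Icc 0 1) η

/-- `(F, η)` is an optimal solution of the first-best program over the contract class `𝓕`. -/
def IsFirstBest {n : ℕ} (𝓕 : Set (Contract n)) (F : Contract n) (η : ℝ) : Prop :=
  (F ∈ 𝓕 ∧ η ∈ Icc (0 : ℝ) 1 ∧ M.IsIR F η) ∧
  ∀ F' ∈ 𝓕, ∀ η' ∈ Icc (0 : ℝ) 1, M.IsIR F' η' → M.expPrincipal F' η' ≤ M.expPrincipal F η

/-- `(F, η)` is an optimal solution of the (unrestricted) second-best program over the contract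
class `𝓕`; the agent's choice `η` is subject to incentive compatibility. -/
def IsSecondBest {n : ℕ} (𝓕 : Set (Contract n)) (F : Contract n) (η : ℝ) : Prop :=
  (F ∈ 𝓕 ∧ M.IsIR F η ∧ M.IsIC F η) ∧
  ∀ F' ∈ 𝓕, ∀ η', M.IsIR F' η' → M.IsIC F' η' → M.expPrincipal F' η' ≤ M.expPrincipal F η

/-- `η` is a first-best quality.  The optimal first-best contract pays a constant wage, so the
number `m` of inspected samples does not matter here and any `m` is allowed. -/
def IsFirstBestEffort (η : ℝ) : Prop :=
  ∃ (m : ℕ) (F : Contract m), M.IsFirstBest (M.contracts m) F η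

/-- `η` is the quality at an optimal solution of the unrestricted second-best program over
binary contracts with `n` inspected samples. -/
def IsBinarySecondBestEffort (n : ℕ) (η : ℝ) : Prop :=
  ∃ F : Contract n, M.IsSecondBest (M.binaryContracts n) F η

end AnnotationModel

end

/-! Write `r = 1 / √(n log n)` and let `w(η)` be the wage with `G_a(w(η)) = E(η) + U_0`. The
second-best value is squeezed between two bounds.

Upper bound: by Jensen (`expPrincipal_le`) an individually rational contract at effort `η` gives the
principal at most `μ(η) - w(η)`. Strict concavity of `G_a` and `E' > 0` make the loss relative to
`η*` at least `κ (η - η*)²` (`exists_quadratic_loss`).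

Lower bound: a threshold contract loses only `O(r)` against the first best
(`exists_binaryContract_near_optimal`). It pays the lowest wage if fewer than `k` samples pass, and
slightly more than `w(η*)` otherwise. The threshold lies at distance of order `√(n log n)` below the
mean at `η*`. There the failure probability at `η*` is at most `r`, while lowering the success
probability by `d` multiplies it by roughly `exp(d √(n log n))`. Once `d` exceeds a multiple of `r`,
the added risk outweighs the effort saved (`exists_threshold`), so every incentive-compatible effort
is at least `η* - O(r)`.

Together, `κ (η_n* - η*)² ≤ C r`. Existence of optimal solutions is compactness of the feasible set.
-/

/-! ### Binomial probabilities -/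

/-- The probability that a binomial variable with parameters `n` and `p` equals `j`. -/
def binomialMass (n : ℕ) (p : ℝ) (j : ℕ) : ℝ := n.choose j * p ^ j * (1 - p) ^ (n - j)

/-- The probability that a binomial variable with parameters `n` and `p` is less than `k`. -/
def binomialBelow (n : ℕ) (p : ℝ) (k : ℕ) : ℝ := ∑ j ∈ Finset.range k, binomialMass n p j

theorem binomialMass_nonneg {p : ℝ} (h0 : 0 ≤ p) (h1 : p ≤ 1) (n j : ℕ) :
    0 ≤ binomialMass n p j := by
  have : 0 ≤ 1 - p := by linarith
  unfold binomialMass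
  positivity

theorem binomialBelow_nonneg {p : ℝ} (h0 : 0 ≤ p) (h1 : p ≤ 1) (n k : ℕ) :
    0 ≤ binomialBelow n p k :=
  Finset.sum_nonneg fun j _ => binomialMass_nonneg h0 h1 n j

theorem binomialBelow_succ_self (n : ℕ) (p : ℝ) : binomialBelow n p (n + 1) = 1 := by
  have h := add_pow p (1 - p) n
  rw [add_sub_cancel, one_pow] at h
  rw [h, binomialBelow]
  refine Finset.sum_congr rfl fun j _ => ?_
  rw [binomialMass]
  ring

theorem binomialBelow_mono {p : ℝ} (h0 : 0 ≤ p) (h1 : p ≤ 1) (n : ℕ) {k m : ℕ} (h : k ≤ m) :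
    binomialBelow n p k ≤ binomialBelow n p m :=
  Finset.sum_le_sum_of_subset_of_nonneg (Finset.range_mono h)
    fun j _ _ => binomialMass_nonneg h0 h1 n j

theorem binomialBelow_le_one {p : ℝ} (h0 : 0 ≤ p) (h1 : p ≤ 1) {n k : ℕ} (h : k ≤ n + 1) :
    binomialBelow n p k ≤ 1 :=
  (binomialBelow_mono h0 h1 n h).trans_eq (binomialBelow_succ_self n p)

theorem sum_sq_mul_binomialMass (n : ℕ) (p : ℝ) :
    ∑ j ∈ Finset.range (n + 1), ((j : ℝ) - n * p) ^ 2 * binomialMass n p j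
      = n * p * (1 - p) := by
  have h := congrArg (Polynomial.eval p) (bernsteinPolynomial.variance ℝ n)
  simp only [Polynomial.eval_finsetSum, bernsteinPolynomial, Polynomial.eval_mul,
    Polynomial.eval_pow, Polynomial.eval_sub, Polynomial.eval_X,
    Polynomial.eval_natCast, Polynomial.eval_one, nsmul_eq_mul] at h
  rw [← h]
  refine Finset.sum_congr rfl fun j _ => ?_
  rw [binomialMass]
  ring

/-- Chebyshev's inequality for the binomial distribution. -/
theorem sum_binomialMass_le_of_far {p : ℝ} (h0 : 0 ≤ p) (h1 : p ≤ 1) (n : ℕ) {t : ℝ} (ht : 0 < t)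
    {s : Finset ℕ} (hs : s ⊆ Finset.range (n + 1)) (hfar : ∀ j ∈ s, t ≤ |(j : ℝ) - n * p|) :
    ∑ j ∈ s, binomialMass n p j ≤ n / (4 * t ^ 2) := by
  have h4 : p * (1 - p) ≤ 1 / 4 := by nlinarith [sq_nonneg (p - 1 / 2)]
  rw [le_div_iff₀ (by positivity)]
  have key : (∑ j ∈ s, binomialMass n p j) * t ^ 2 ≤ n * p * (1 - p) := by
    rw [← sum_sq_mul_binomialMass, Finset.sum_mul]
    calc ∑ j ∈ s, binomialMass n p j * t ^ 2
        ≤ ∑ j ∈ s, ((j : ℝ) - n * p) ^ 2 * binomialMass n p j := by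
          refine Finset.sum_le_sum fun j hj => ?_
          rw [mul_comm]
          refine mul_le_mul_of_nonneg_right ?_ (binomialMass_nonneg h0 h1 n j)
          rw [← sq_abs ((j : ℝ) - n * p)]
          have := hfar j hj
          gcongr
      _ ≤ _ := Finset.sum_le_sum_of_subset_of_nonneg hs fun j _ _ =>
          mul_nonneg (sq_nonneg _) (binomialMass_nonneg h0 h1 n j)
  have : (n : ℝ) * (p * (1 - p)) ≤ n * (1 / 4) := by gcongr
  nlinarith

/-! ### Change of the success probability and tail estimates. -/

theorem exp_sub_two_mul_sq_le {x : ℝ} (hx : -(1 / 2) ≤ x) : Real.exp (x - 2 * x ^ 2) ≤ 1 + x := by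
  have h1 : 0 < 1 + x := by linarith
  rw [← Real.le_log_iff_exp_le h1]
  refine le_trans ?_ (Real.one_sub_inv_le_log_of_pos h1)
  rw [← sub_nonneg]
  have : 1 - (1 + x)⁻¹ - (x - 2 * x ^ 2) = x ^ 2 * (1 + 2 * x) / (1 + x) := by
    field_simp
    ring
  rw [this]
  have : 0 ≤ 1 + 2 * x := by linarith
  positivity

/-- Comparison of the binomial weights for the parameters `p - d` and `p`. -/
theorem binomialMass_mul_exp_le {p d : ℝ} (h0 : 0 < p) (h1 : p < 1) (hd : d ≤ p / 2)
    (hd' : -((1 - p) / 2) ≤ d) {n j : ℕ} (hj : j ≤ n) :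
    binomialMass n p j * Real.exp (d * (n * p - j) / (p * (1 - p))
        - n * d ^ 2 * (2 * (1 / p ^ 2 + 1 / (1 - p) ^ 2))) ≤ binomialMass n (p - d) j := by
  have hq : 0 < 1 - p := by linarith
  have ha : Real.exp (-(d / p) - 2 * (-(d / p)) ^ 2) ≤ 1 + -(d / p) := by
    refine exp_sub_two_mul_sq_le ?_
    rw [neg_le_neg_iff, div_le_iff₀ h0]
    linarith
  have hb : Real.exp (d / (1 - p) - 2 * (d / (1 - p)) ^ 2) ≤ 1 + d / (1 - p) := by
    refine exp_sub_two_mul_sq_le ?_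
    rw [le_div_iff₀ hq]
    linarith
  have hpa : p - d = p * (1 + -(d / p)) := by field_simp; ring
  have hpb : 1 - (p - d) = (1 - p) * (1 + d / (1 - p)) := by field_simp; ring
  have hexp : Real.exp (d * (n * p - j) / (p * (1 - p))
        - n * d ^ 2 * (2 * (1 / p ^ 2 + 1 / (1 - p) ^ 2))) ≤
      (1 + -(d / p)) ^ j * (1 + d / (1 - p)) ^ (n - j) := by
    calc _ ≤ Real.exp (-(d / p) - 2 * (-(d / p)) ^ 2) ^ j
          * Real.exp (d / (1 - p) - 2 * (d / (1 - p)) ^ 2) ^ (n - j) := by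
          rw [← Real.exp_nat_mul, ← Real.exp_nat_mul, ← Real.exp_add, Real.exp_le_exp,
            Nat.cast_sub hj, ← sub_nonneg]
          have hjn : (j : ℝ) ≤ n := by exact_mod_cast hj
          -- The first-order terms combine exactly. In the second-order terms `j` and `n - j` are
          -- both enlarged to `n`, and the difference displayed here is the resulting slack.
          have e : (j : ℝ) * (-(d / p) - 2 * (-(d / p)) ^ 2)
              + (n - j) * (d / (1 - p) - 2 * (d / (1 - p)) ^ 2)
              - (d * (n * p - j) / (p * (1 - p))
                - n * d ^ 2 * (2 * (1 / p ^ 2 + 1 / (1 - p) ^ 2)))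
              = 2 * ((n - j) * (d / p) ^ 2 + j * (d / (1 - p)) ^ 2) := by
            field_simp
            ring
          rw [e]
          have : 0 ≤ (n : ℝ) - j := by linarith
          positivity
      _ ≤ _ := by
          have := (Real.exp_pos _).le.trans ha
          gcongr
  rw [binomialMass, binomialMass, hpb, hpa, mul_pow, mul_pow]
  have := mul_le_mul_of_nonneg_left hexp (by positivity :
    0 ≤ (n.choose j : ℝ) * p ^ j * (1 - p) ^ (n - j))
  refine this.trans (le_of_eq ?_)
  ring

/-- The likelihood ratio of `p - d` against `p` decreases in the count, so on the whole tail it is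
at least its bound at `x`. Only `k - 1 ≤ x` is required, which lets the same `x = k` serve the tails
below `k` and below `k + 1`. -/
theorem binomialBelow_mul_exp_le {p d : ℝ} (h0 : 0 < p) (h1 : p < 1) (hd : d ≤ p / 2)
    (hd' : 0 ≤ d) {n k : ℕ} (hk : k ≤ n + 1) {x : ℝ} (hx : (k : ℝ) ≤ x + 1) :
    binomialBelow n p k * Real.exp (d * (n * p - x) / (p * (1 - p))
        - n * d ^ 2 * (2 * (1 / p ^ 2 + 1 / (1 - p) ^ 2))) ≤ binomialBelow n (p - d) k := by
  have hq : 0 < 1 - p := by linarith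
  rw [binomialBelow, binomialBelow, Finset.sum_mul]
  refine Finset.sum_le_sum fun j hj => ?_
  have hjk : j + 1 ≤ k := Finset.mem_range.1 hj
  refine le_trans ?_ (binomialMass_mul_exp_le h0 h1 hd (by linarith) (n := n) (j := j) (by omega))
  refine mul_le_mul_of_nonneg_left ?_ (binomialMass_nonneg h0.le h1.le n j)
  have hjx : (j : ℝ) ≤ x := by
    have : ((j + 1 : ℕ) : ℝ) ≤ k := by exact_mod_cast hjk
    push_cast at this
    linarith
  rw [Real.exp_le_exp]
  gcongr

/-- Stochastic monotonicity of the binomial distribution in its success probability. -/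
theorem binomialBelow_antitone {p p' : ℝ} (h0 : 0 < p') (hp : p' ≤ p) (h1 : p < 1) {n k : ℕ}
    (hk : k ≤ n) : binomialBelow n p k ≤ binomialBelow n p' k := by
  have hp0 : 0 < p := by linarith
  have hq : 0 < 1 - p := by linarith
  have hq' : 0 < 1 - p' := by linarith
  set u := p' / p with hu
  set v := (1 - p') / (1 - p) with hv
  have hu0 : 0 ≤ u := by positivity
  have hu1 : u ≤ 1 := (div_le_one hp0).2 hp
  have hv1 : 1 ≤ v := (one_le_div hq).2 (by linarith)
  have hmass : ∀ j, binomialMass n p' j = binomialMass n p j * (u ^ j * v ^ (n - j)) := by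
    intro j
    have e1 : p' = p * u := by rw [hu]; field_simp
    have e2 : 1 - p' = (1 - p) * v := by rw [hv]; field_simp
    rw [binomialMass, binomialMass, e2, e1, mul_pow, mul_pow]
    ring
  have hanti : ∀ i j, i ≤ j → u ^ j * v ^ (n - j) ≤ u ^ i * v ^ (n - i) := by
    intro i j hij
    have a1 := pow_le_pow_of_le_one hu0 hu1 hij
    have a2 := pow_le_pow_right₀ hv1 (by omega : n - j ≤ n - i)
    gcongr
  -- The likelihood ratio `u ^ j * v ^ (n - j)` decreases in `j`. If it is at least `1` at `k`,
  -- every mass below `k` grows; otherwise every mass from `k` on shrinks, and the complement is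
  -- compared.
  rcases le_total 1 (u ^ k * v ^ (n - k)) with h | h
  · refine Finset.sum_le_sum fun j hj => ?_
    rw [hmass j]
    exact le_mul_of_one_le_right (binomialMass_nonneg hp0.le h1.le n j)
      (h.trans (hanti j k (Finset.mem_range.1 hj).le))
  · have split : ∀ q, binomialBelow n q k
        = 1 - ∑ j ∈ Finset.Ico k (n + 1), binomialMass n q j := by
      intro q
      rw [← binomialBelow_succ_self n q, binomialBelow, binomialBelow,
        ← Finset.sum_range_add_sum_Ico _ (by omega : k ≤ n + 1)]
      ring
    rw [split, split]
    refine sub_le_sub_left (Finset.sum_le_sum fun j hj => ?_) 1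
    rw [hmass j]
    exact mul_le_of_le_one_right (binomialMass_nonneg hp0.le h1.le n j)
      ((hanti k j (Finset.mem_Ico.1 hj).1).trans h)

/-- A Gaussian lower bound for the lower tail of the binomial distribution. -/
theorem exists_exp_le_binomialBelow {p : ℝ} (hp : 1 / 2 < p) (h1 : p < 1) :
    ∃ K > 0, ∀ (n k : ℕ) (y : ℝ), 0 < n → 0 < y → n ≤ 2 * y ^ 2 → 2 * y / n ≤ p - 1 / 2 →
      2 * y / n ≤ (1 - p) / 2 → n * p - y < k → k ≤ n + 1 →
      1 / 2 * Real.exp (-(K * (y ^ 2 / n))) ≤ binomialBelow n p k := by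
  have hq : 0 < 1 - p := by linarith
  refine ⟨4 / (1 - p) + 8 * (4 + 1 / (1 - p) ^ 2), by positivity, ?_⟩
  intro n k y hn hy hny hyp hyq hk hkn
  have hn' : (0 : ℝ) < n := by exact_mod_cast hn
  -- Tilting: under `p - δ` the mean is `n * p - 2 * y`, so the window of radius `y` around it lies
  -- below `k` and has mass at least `1 / 2` by Chebyshev. Returning to `p` costs a factor `exp(-K
  -- y² / n)`.
  set δ := 2 * y / n with hδ
  have hδ0 : 0 < δ := by positivity
  have hnδ : n * δ = 2 * y := by rw [hδ]; field_simp
  set p' := p - δ with hp'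
  have hp2 : 1 / 2 ≤ p' := by linarith
  have hq' : 1 - p ≤ 1 - p' := by linarith
  have hq'0 : 0 < 1 - p' := by linarith
  classical
  set s := (Finset.range (n + 1)).filter fun j : ℕ => |(j : ℝ) - n * p'| ≤ y with hs
  have hs_mass : 1 / 2 ≤ ∑ j ∈ s, binomialMass n p' j := by
    have h := Finset.sum_filter_add_sum_filter_not (Finset.range (n + 1))
      (fun j : ℕ => |(j : ℝ) - n * p'| ≤ y) (binomialMass n p')
    have hfar := sum_binomialMass_le_of_far (p := p') (by linarith) (by linarith) n hy
      (s := (Finset.range (n + 1)).filter fun j : ℕ => ¬ |(j : ℝ) - n * p'| ≤ y)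
      (Finset.filter_subset _ _) (fun j hj => (not_le.1 (Finset.mem_filter.1 hj).2).le)
    have hb : (n : ℝ) / (4 * y ^ 2) ≤ 1 / 2 := by
      rw [div_le_iff₀ (by positivity)]
      linarith
    have h1 := binomialBelow_succ_self n p'
    rw [binomialBelow] at h1
    rw [← hs] at h
    linarith
  have hsub : s ⊆ Finset.range k := by
    intro j hj
    have h := (abs_le.1 (Finset.mem_filter.1 hj).2).2
    have e : n * p' = n * p - 2 * y := by rw [hp', mul_sub, hnδ]
    rw [Finset.mem_range]
    have : (j : ℝ) < k := by linarith
    exact_mod_cast this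
  have hpt : ∀ j ∈ s, binomialMass n p' j *
      Real.exp (-((4 / (1 - p) + 8 * (4 + 1 / (1 - p) ^ 2)) * (y ^ 2 / n)))
        ≤ binomialMass n p j := by
    intro j hj
    have hj' := Finset.mem_filter.1 hj
    have h := binomialMass_mul_exp_le (p := p') (d := -δ) (by linarith) (by linarith)
      (by linarith) (by linarith) (n := n) (j := j) (by have := Finset.mem_range.1 hj'.1; omega)
    rw [hp', sub_neg_eq_add, sub_add_cancel, ← hp'] at h
    refine le_trans (mul_le_mul_of_nonneg_left ?_
      (binomialMass_nonneg (by linarith) (by linarith) n j)) h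
    rw [Real.exp_le_exp]
    have hz := (abs_le.1 hj'.2).1
    have hv : 1 / (p' * (1 - p')) ≤ 2 / (1 - p) := by
      rw [div_le_div_iff₀ (by positivity) hq]
      nlinarith
    have hD : 2 * (1 / p' ^ 2 + 1 / (1 - p') ^ 2) ≤ 2 * (4 + 1 / (1 - p) ^ 2) := by
      have e1 : 1 / p' ^ 2 ≤ 4 := by
        rw [div_le_iff₀ (by positivity)]
        nlinarith
      have e2 : 1 / (1 - p') ^ 2 ≤ 1 / (1 - p) ^ 2 := by gcongr
      linarith
    have t1 : δ * (n * p' - j) / (p' * (1 - p')) ≤ δ * y * (2 / (1 - p)) := by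
      have : δ * (n * p' - j) / (p' * (1 - p')) ≤ δ * y * (1 / (p' * (1 - p'))) := by
        rw [mul_one_div]
        have : n * p' - j ≤ y := by linarith
        gcongr
      refine this.trans ?_
      gcongr
    have t2 : n * δ ^ 2 * (2 * (1 / p' ^ 2 + 1 / (1 - p') ^ 2))
        ≤ n * δ ^ 2 * (2 * (4 + 1 / (1 - p) ^ 2)) := by gcongr
    have e1 : δ * y * (2 / (1 - p)) = 4 / (1 - p) * (y ^ 2 / n) := by
      rw [hδ]; field_simp; ring
    have e2 : n * δ ^ 2 * (2 * (4 + 1 / (1 - p) ^ 2))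
        = 8 * (4 + 1 / (1 - p) ^ 2) * (y ^ 2 / n) := by
      rw [hδ]; field_simp; ring
    have e3 : -δ * (n * p' - j) / (p' * (1 - p')) = -(δ * (n * p' - j) / (p' * (1 - p'))) := by
      ring
    have e4 : n * (-δ) ^ 2 * (2 * (1 / p' ^ 2 + 1 / (1 - p') ^ 2))
        = n * δ ^ 2 * (2 * (1 / p' ^ 2 + 1 / (1 - p') ^ 2)) := by ring
    rw [e3, e4]
    linarith
  calc _ ≤ (∑ j ∈ s, binomialMass n p' j) *
        Real.exp (-((4 / (1 - p) + 8 * (4 + 1 / (1 - p) ^ 2)) * (y ^ 2 / n))) := by gcongr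
    _ ≤ ∑ j ∈ s, binomialMass n p j := by
        rw [Finset.sum_mul]
        exact Finset.sum_le_sum hpt
    _ ≤ _ := Finset.sum_le_sum_of_subset_of_nonneg hsub
        fun j _ _ => binomialMass_nonneg (by linarith) h1.le n j

/-- Consecutive masses have ratio `(n - i) p / ((i + 1)(1 - p))`, bounded when `i + 1 ≥ n / 4`, and
the last mass below `k` is part of the tail. Hence a maximal threshold has failure probability
comparable to the prescribed level. -/
theorem binomialBelow_succ_le {p : ℝ} (h0 : 0 < p) (h1 : p < 1) {n k : ℕ} (hk : k ≤ n)
    (hn : 0 < n) (hnk : (n : ℝ) ≤ 4 * k) :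
    binomialBelow n p (k + 1) ≤ (1 + 4 / (1 - p)) * binomialBelow n p k := by
  have hq : 0 < 1 - p := by linarith
  obtain ⟨i, rfl⟩ : ∃ i, k = i + 1 := by
    refine Nat.exists_eq_succ_of_ne_zero ?_
    rintro rfl
    have : (0 : ℝ) < n := by exact_mod_cast hn
    simp at hnk
    omega
  have hch : (n.choose (i + 1) : ℝ) * (i + 1) = n.choose i * (n - i) := by
    have := Nat.choose_succ_right_eq n i
    have h : ((n.choose (i + 1) * (i + 1) : ℕ) : ℝ) = ((n.choose i * (n - i) : ℕ) : ℝ) := by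
      rw [this]
    rw [Nat.cast_mul, Nat.cast_mul, Nat.cast_sub (by omega)] at h
    push_cast at h
    exact h
  have hmass : binomialMass n p (i + 1) * ((i + 1) * (1 - p))
      = binomialMass n p i * ((n - i) * p) := by
    have e : n - i = n - (i + 1) + 1 := by omega
    rw [binomialMass, binomialMass, e, pow_succ (1 - p), pow_succ p]
    linear_combination (p ^ i * p * (1 - p) ^ (n - (i + 1)) * (1 - p)) * hch
  have hle : binomialMass n p (i + 1) ≤ 4 / (1 - p) * binomialMass n p i := by
    have hm := binomialMass_nonneg h0.le h1.le n i
    have hi : (0 : ℝ) < i + 1 := by positivity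
    rw [← mul_le_mul_iff_left₀ (by positivity : 0 < ((i : ℝ) + 1) * (1 - p)), hmass]
    have e : 4 / (1 - p) * binomialMass n p i * ((i + 1) * (1 - p))
        = binomialMass n p i * (4 * (i + 1)) := by field_simp
    rw [e]
    push_cast at hnk
    refine mul_le_mul_of_nonneg_left ?_ hm
    have : (i : ℝ) + 1 ≤ n := by exact_mod_cast hk
    nlinarith
  have hlast : binomialMass n p i ≤ binomialBelow n p (i + 1) := by
    rw [binomialBelow, Finset.sum_range_succ]
    have := binomialBelow_nonneg h0.le h1.le n i
    rw [binomialBelow] at this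
    linarith
  have : binomialBelow n p (i + 1 + 1) = binomialBelow n p (i + 1) + binomialMass n p (i + 1) := by
    rw [binomialBelow, Finset.sum_range_succ, ← binomialBelow]
  rw [this, add_mul, one_mul]
  have : 4 / (1 - p) * binomialMass n p i ≤ 4 / (1 - p) * binomialBelow n p (i + 1) := by gcongr
  linarith

/-! ### The scale `√(n log n)` and the choice of the threshold. -/

theorem tendsto_log_natCast_atTop : Tendsto (fun n : ℕ => Real.log n) atTop atTop :=
  Real.tendsto_log_atTop.comp tendsto_natCast_atTop_atTop

theorem tendsto_sqrt_mul_log_div :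
    Tendsto (fun n : ℕ => Real.sqrt (n * Real.log n) / n) atTop (𝓝 0) := by
  have h : Tendsto (fun n : ℕ => Real.sqrt (Real.log n / n)) atTop (𝓝 0) := by
    have h1 : Tendsto (fun x : ℝ => Real.log x / x) atTop (𝓝 0) :=
      Real.isLittleO_log_id_atTop.tendsto_div_nhds_zero
    have h2 := (Real.continuous_sqrt.tendsto 0).comp (h1.comp tendsto_natCast_atTop_atTop)
    rw [Real.sqrt_zero] at h2
    exact h2
  refine h.congr' ?_
  filter_upwards [eventually_gt_atTop 0] with n hn
  have hn' : (0 : ℝ) < n := by exact_mod_cast hn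
  have e : Real.log n / n = n * Real.log n / (n : ℝ) ^ 2 := by field_simp
  rw [e, Real.sqrt_div' _ (by positivity), Real.sqrt_sq hn'.le]

theorem tendsto_one_div_sqrt_mul_log :
    Tendsto (fun n : ℕ => 1 / Real.sqrt (n * Real.log n)) atTop (𝓝 0) := by
  have h : Tendsto (fun n : ℕ => Real.sqrt (n * Real.log n)) atTop atTop :=
    Real.tendsto_sqrt_atTop.comp
      ((tendsto_natCast_atTop_atTop (R := ℝ)).atTop_mul_atTop₀ tendsto_log_natCast_atTop)
  simp only [one_div]
  exact h.inv_tendsto_atTop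

set_option maxHeartbeats 1000000 in
/-- For a success probability `p`, there are thresholds `k` at which the failure probability is of
order at most `1 / √(n log n)`, but grows quickly when `p` is lowered by more than a multiple
of `1 / √(n log n)`. -/
theorem exists_threshold {p : ℝ} (hp : 1 / 2 < p) (h1 : p < 1) {A ε : ℝ} (hA : 0 < A)
    (hε : 0 < ε) :
    ∃ C > 0, ∀ᶠ n : ℕ in atTop, ∃ k : ℕ, k ≤ n ∧
      binomialBelow n p k ≤ 1 / Real.sqrt (n * Real.log n) ∧
      ∀ d, C * (1 / Real.sqrt (n * Real.log n)) ≤ d → d ≤ p - 1 / 2 →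
        A * (1 / Real.sqrt (n * Real.log n) + d) ≤ binomialBelow n (p - d) k ∨
        1 - ε ≤ binomialBelow n (p - d) k := by
  have h0 : 0 < p := by linarith
  have hq : 0 < 1 - p := by linarith
  obtain ⟨K, hK, htail⟩ := exists_exp_le_binomialBelow hp h1
  set D := 2 * (1 / p ^ 2 + 1 / (1 - p) ^ 2) with hD
  have hD0 : 0 < D := by positivity
  -- With this `c₀` the Gaussian lower bound at distance `c₀ * ρ` from the mean equals `n ^ (-1/4) /
  -- 2`, which exceeds `n ^ (-1/2) ≥ r`.
  set c₀ := 1 / (2 * Real.sqrt K) with hc₀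
  have hc₀0 : 0 < c₀ := by positivity
  have hKc : K * c₀ ^ 2 = 1 / 4 := by
    rw [hc₀, div_pow, mul_pow, Real.sq_sqrt hK.le]
    field_simp
    norm_num
  set K₀ := 1 + D with hK₀
  set b := 1 + 4 / (1 - p) with hb
  have hb0 : 0 < b := by positivity
  set γ := c₀ ^ 2 / (4 * D) with hγ
  have hγ0 : 0 < γ := by positivity
  set C := 1 + 16 * A * b / c₀ ^ 2 with hC
  have hC0 : 0 < C := by positivity
  refine ⟨C, hC0, ?_⟩
  have hsmall : ∀ a : ℝ, 0 < a → ∀ᶠ n : ℕ in atTop, Real.sqrt (n * Real.log n) / n < a :=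
    fun a ha => tendsto_sqrt_mul_log_div.eventually (gt_mem_nhds ha)
  filter_upwards [eventually_gt_atTop 0, tendsto_log_natCast_atTop.eventually_ge_atTop 4,
    tendsto_log_natCast_atTop.eventually_ge_atTop (1 / (2 * c₀ ^ 2)),
    tendsto_log_natCast_atTop.eventually_ge_atTop (A * b * (2 + K₀) * 2 / γ ^ 2),
    tendsto_log_natCast_atTop.eventually_ge_atTop (1 / (4 * ε)),
    hsmall ((p - 1 / 2) / (2 * c₀)) (by apply div_pos <;> linarith),
    hsmall ((1 - p) / (4 * c₀)) (by positivity),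
    hsmall (p - 1 / 2) (by linarith), hsmall (1 / (4 * K₀)) (by positivity)]
    with n hn hL4 hLc hLγ hLε hs1 hs2 hs3 hs4
  have hn' : (0 : ℝ) < n := by exact_mod_cast hn
  set L := Real.log n with hL
  set ρ := Real.sqrt (n * L) with hρ
  have hL0 : 0 < L := by linarith
  have hρ0 : 0 < ρ := Real.sqrt_pos.2 (by positivity)
  have hρ2 : ρ ^ 2 = n * L := Real.sq_sqrt (by positivity)
  have hexpL : Real.exp L = n := Real.exp_log hn'
  have hρn : ρ ≤ n := by
    have : L ≤ n := (Real.log_le_sub_one_of_pos hn').trans (by linarith)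
    rw [hρ, Real.sqrt_le_left hn'.le, sq]
    gcongr
  have hLnL : L ≤ n * L := le_mul_of_one_le_left hL0.le (by exact_mod_cast hn)
  set r := 1 / ρ with hr
  have hr0 : 0 < r := by positivity
  have hrρ : r * ρ = 1 := by rw [hr]; field_simp
  have hρdiv : ρ / n = r * L := by
    rw [hr]; field_simp; rw [hρ2]
  have hr1 : r < 1 := by
    rw [hr, div_lt_one hρ0]
    exact Real.lt_sqrt_of_sq_lt (by linarith)
  classical
  -- Maximality makes the failure probability at `k + 1` exceed `r`; for `k = n` this holds because
  -- that probability is `1`.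
  set k := Nat.findGreatest (fun j => binomialBelow n p j ≤ r) n with hk
  have hkn : k ≤ n := Nat.findGreatest_le n
  have hkr : binomialBelow n p k ≤ r := by
    have := Nat.findGreatest_spec (P := fun j => binomialBelow n p j ≤ r) (Nat.zero_le n)
      (by simp [binomialBelow, hr0.le])
    exact this
  have hk1 : r < binomialBelow n p (k + 1) := by
    rcases hkn.eq_or_lt with h | h
    · rw [h, binomialBelow_succ_self]
      exact hr1
    · exact not_le.1 (Nat.findGreatest_is_greatest (P := fun j => binomialBelow n p j ≤ r)
        (Nat.lt_succ_self k) h)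
  set y := n * p - k with hy
  -- lower bound on the distance to the mean
  have hylow : c₀ * ρ ≤ y := by
    by_contra! hlt
    have h := htail n k (c₀ * ρ) hn (by positivity) ?_ ?_ ?_ (by linarith) (by omega)
    · have e1 : K * ((c₀ * ρ) ^ 2 / n) = L / 4 := by
        rw [mul_pow, hρ2]
        field_simp
        linear_combination 4 * hKc
      rw [e1] at h
      have hrle : r ≤ Real.exp (-(L / 2)) := by
        have : Real.exp (L / 2) ≤ ρ := by
          rw [hρ]
          refine Real.le_sqrt_of_sq_le ?_
          rw [← Real.exp_nat_mul]
          have : ((2 : ℕ) : ℝ) * (L / 2) = L := by push_cast; ring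
          rw [this, hexpL]
          exact le_mul_of_one_le_right hn'.le (by linarith)
        rw [Real.exp_neg, hr, one_div]
        gcongr
      have hexp : Real.exp (-(L / 2)) < 1 / 2 * Real.exp (-(L / 4)) := by
        have e : Real.exp (-(L / 2)) = Real.exp (-(L / 4)) * Real.exp (-(L / 4)) := by
          rw [← Real.exp_add]; congr 1; ring
        have : Real.exp (-(L / 4)) < 1 / 2 := by
          rw [Real.exp_neg, inv_eq_one_div]
          refine one_div_lt_one_div_of_lt two_pos ?_
          have := Real.add_one_lt_exp (x := L / 4) (by positivity)
          linarith
        rw [e]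
        exact mul_lt_mul_of_pos_right this (Real.exp_pos _)
      linarith
    · rw [mul_pow, hρ2]
      rw [div_le_iff₀ (by positivity)] at hLc
      linarith [mul_le_mul_of_nonneg_left hLc hn'.le]
    · rw [lt_div_iff₀ (by positivity)] at hs1
      have : 2 * (c₀ * ρ) / n = ρ / n * (2 * c₀) := by ring
      linarith
    · rw [lt_div_iff₀ (by positivity)] at hs2
      have : 2 * (c₀ * ρ) / n = ρ / n * (4 * c₀) / 2 := by ring
      linarith
  have hy0 : 0 < y := lt_of_lt_of_le (by positivity) hylow
  -- the effect of lowering the success probability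
  have hv : p * (1 - p) ≤ 1 := mul_le_one₀ h1.le hq.le (by linarith)
  have hvpos : 0 < p * (1 - p) := by positivity
  have hgrow : ∀ m, m = k ∨ m = k + 1 → ∀ d, 0 ≤ d → d ≤ p - 1 / 2 →
      binomialBelow n p m * Real.exp (d * y - n * d ^ 2 * D) ≤ binomialBelow n (p - d) m := by
    intro m hm d hd0 hd
    have h := binomialBelow_mul_exp_le (p := p) (d := d) h0 h1 (by linarith) hd0
      (n := n) (k := m) (by omega) (x := k) (by rcases hm with rfl | rfl <;> push_cast <;> linarith)
    refine le_trans (mul_le_mul_of_nonneg_left ?_ (binomialBelow_nonneg h0.le h1.le n m)) h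
    rw [Real.exp_le_exp]
    refine sub_le_sub_right ?_ _
    rw [le_div_iff₀ hvpos]
    exact mul_le_of_le_one_right (by positivity) hv
  -- Lowering `p` by `ρ / n` amplifies the tail at `k + 1`, which starts above `r`, yet the result
  -- is a probability. So the amplification is at most `1 / r = ρ ≤ n = exp L`.
  have hyup : y ≤ K₀ * ρ := by
    have hd0 : 0 ≤ ρ / n := by positivity
    have h := (hgrow (k + 1) (Or.inr rfl) (ρ / n) hd0 hs3.le).trans
      (binomialBelow_le_one (by linarith) (by linarith) (by omega))
    have h2 : r * Real.exp (ρ / n * y - n * (ρ / n) ^ 2 * D) ≤ 1 := le_trans (by gcongr) h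
    have h3 : Real.exp (ρ / n * y - n * (ρ / n) ^ 2 * D) ≤ Real.exp L := by
      rw [hexpL]
      refine le_trans ?_ hρn
      rw [hr, one_div, inv_mul_le_iff₀ hρ0, mul_one] at h2
      exact h2
    rw [Real.exp_le_exp] at h3
    have e : n * (ρ / n) ^ 2 * D = D * L := by
      rw [div_pow, hρ2]; field_simp
    have h4 : ρ / n * y ≤ K₀ * L := by rw [hK₀]; linarith
    have h5 : ρ * y ≤ ρ * (K₀ * ρ) := by
      have e2 : ρ * (K₀ * ρ) = n * (K₀ * L) := by linear_combination K₀ * hρ2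
      have e3 : ρ * y = n * (ρ / n * y) := by field_simp
      rw [e2, e3]
      gcongr
    exact le_of_mul_le_mul_left h5 hρ0
  have hklow : (n : ℝ) ≤ 4 * k := by
    rw [lt_div_iff₀ (by positivity), div_mul_eq_mul_div, div_lt_iff₀ hn'] at hs4
    linarith [mul_le_mul_of_nonneg_left hp.le hn'.le]
  have hlow : r / b ≤ binomialBelow n p k := by
    rw [div_le_iff₀ hb0, mul_comm]
    exact hk1.le.trans (binomialBelow_succ_le h0 h1 hkn hn hklow)
  refine ⟨k, hkn, hkr, fun d hCd hd => ?_⟩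
  have hd0 : 0 < d := lt_of_lt_of_le (by positivity) hCd
  -- `d₀` maximizes `d * (c₀ * ρ) - n * d ^ 2 * D`; up to it the quadratic loss takes at most half
  -- of the linear gain. Below `d₀`, `exp t ≥ t ^ 2 / 2` gives growth quadratic in `d * ρ`, which
  -- beats `A * (r + d)` once `d * ρ ≥ C`.
  set d₀ := c₀ * ρ / (2 * D * n) with hd₀
  have hd₀0 : 0 < d₀ := by positivity
  have hexponent : ∀ d, 0 ≤ d → d ≤ d₀ → d * (c₀ * ρ / 2) ≤ d * y - n * d ^ 2 * D := by
    intro d hd hdd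
    rw [hd₀, le_div_iff₀ (by positivity)] at hdd
    have a1 : d * (c₀ * ρ) ≤ d * y := by gcongr
    have a2 : d * (d * (2 * D * n)) ≤ d * (c₀ * ρ) := by gcongr
    linarith
  rcases le_total d d₀ with hdd | hdd
  · left
    refine le_trans ?_ (hgrow k (Or.inl rfl) d hd0.le hd)
    have a1 : (d * (c₀ * ρ / 2)) ^ 2 / 2 ≤ Real.exp (d * y - n * d ^ 2 * D) := by
      have := Real.quadratic_le_exp_of_nonneg (x := d * (c₀ * ρ / 2)) (by positivity)
      have h2 := Real.exp_le_exp.2 (hexponent d hd0.le hdd)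
      have : 0 ≤ d * (c₀ * ρ / 2) := by positivity
      linarith
    refine le_trans ?_ (mul_le_mul hlow a1 (by positivity)
      (binomialBelow_nonneg h0.le h1.le n k))
    set x := d * ρ with hx
    have hxd : d = r * x := by rw [hx]; linear_combination -d * hrρ
    have hxC : C ≤ x := by
      have := mul_le_mul_of_nonneg_right hCd hρ0.le
      rw [mul_assoc, hrρ, mul_one] at this
      exact this
    have e : r / b * ((d * (c₀ * ρ / 2)) ^ 2 / 2) = r * (c₀ ^ 2 / (8 * b) * x ^ 2) := by
      rw [hx]; field_simp; ring
    have e2 : A * (r + d) = r * (A * (1 + x)) := by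
      rw [hxd]; ring
    rw [e, e2]
    refine mul_le_mul_of_nonneg_left ?_ hr0.le
    have hx1 : 1 ≤ x := le_trans (by rw [hC]; have : 0 ≤ 16 * A * b / c₀ ^ 2 := by positivity
                                     linarith) hxC
    have hx2 : 16 * A * b / c₀ ^ 2 ≤ x := by linarith
    rw [div_le_iff₀ (by positivity)] at hx2
    have h3 : 2 * A ≤ c₀ ^ 2 / (8 * b) * x := by
      rw [div_mul_eq_mul_div, le_div_iff₀ (by positivity)]
      linarith
    linarith [mul_le_mul_of_nonneg_left hx1 hA.le,
      mul_le_mul_of_nonneg_right h3 (by linarith : 0 ≤ x)]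
  -- In the middle range monotonicity reduces to `d₀`: the tail is at least of order `r * L ^ 2`,
  -- while `r + d` is of order `r * L` because `ρ / n = r * L`.
  · rcases le_total d ((K₀ + 1) * (ρ / n)) with hd1 | hd1
    · left
      have hm := binomialBelow_antitone (p := p - d₀) (p' := p - d) (by linarith) (by linarith)
        (by linarith) hkn
      refine le_trans ?_ hm
      refine le_trans ?_ (hgrow k (Or.inl rfl) d₀ hd₀0.le (by linarith))
      have eγ : d₀ * (c₀ * ρ / 2) = γ * L := by
        have : d₀ * (c₀ * ρ / 2) = c₀ ^ 2 * ρ ^ 2 / (4 * D * n) := by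
          rw [hd₀]; field_simp; ring
        rw [this, hρ2, hγ]
        field_simp
      have a1 : (γ * L) ^ 2 / 2 ≤ Real.exp (d₀ * y - n * d₀ ^ 2 * D) := by
        have := Real.quadratic_le_exp_of_nonneg (x := γ * L) (by positivity)
        have h2 := Real.exp_le_exp.2 (hexponent d₀ hd₀0.le le_rfl)
        rw [eγ] at h2
        have : 0 ≤ γ * L := by positivity
        linarith
      refine le_trans ?_ (mul_le_mul hlow a1 (by positivity)
        (binomialBelow_nonneg h0.le h1.le n k))
      have hdr : r + d ≤ r * ((2 + K₀) * L) := by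
        rw [hρdiv] at hd1
        linarith [mul_le_mul_of_nonneg_left (by linarith : 1 ≤ L) hr0.le]
      rw [div_le_iff₀ (by positivity)] at hLγ
      calc A * (r + d) ≤ A * (r * ((2 + K₀) * L)) := by gcongr
        _ = r / b * (A * b * (2 + K₀) * 2 * L / 2) := by field_simp
        _ ≤ r / b * ((γ * L) ^ 2 / 2) := by
            refine mul_le_mul_of_nonneg_left ?_ (by positivity)
            linarith [mul_le_mul_of_nonneg_right hLγ hL0.le]
    -- Here the mean at `p - d` lies at least `ρ` below `k`, so by Chebyshev the test is passed with
    -- probability at most `n / (4 ρ²) = 1 / (4 L) ≤ ε`.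
    · right
      have hcheb := sum_binomialMass_le_of_far (p := p - d) (by linarith) (by linarith) n hρ0
        (s := Finset.Ico k (n + 1)) (fun j hj => by
          rw [Finset.mem_Ico] at hj
          exact Finset.mem_range.2 hj.2) (fun j hj => by
          refine le_trans ?_ (le_abs_self _)
          have hkj : (k : ℝ) ≤ j := by exact_mod_cast (Finset.mem_Ico.1 hj).1
          have : (K₀ + 1) * ρ ≤ n * d := by
            rw [mul_div_assoc', div_le_iff₀ hn'] at hd1
            linarith
          linarith)
      have hsum := binomialBelow_succ_self n (p - d)
      rw [binomialBelow, ← Finset.sum_range_add_sum_Ico _ (by omega : k ≤ n + 1)] at hsum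
      have hfin : (n : ℝ) / (4 * ρ ^ 2) ≤ ε := by
        rw [hρ2, div_le_iff₀ (by positivity)]
        rw [div_le_iff₀ (by positivity)] at hLε
        linarith [mul_le_mul_of_nonneg_left hLε hn'.le]
      rw [binomialBelow]
      linarith

/-! ### Calculus on compact intervals -/

theorem sub_mem_Icc_of_derivWithin_mem_Icc {f : ℝ → ℝ} {a b m L : ℝ}
    (hf : DifferentiableOn ℝ f (Icc a b))
    (hd : ∀ x ∈ Icc a b, derivWithin f (Icc a b) x ∈ Icc m L) {x y : ℝ} (hx : x ∈ Icc a b)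
    (hy : y ∈ Icc a b) (hxy : x ≤ y) : f y - f x ∈ Icc (m * (y - x)) (L * (y - x)) := by
  have hderiv : ∀ z ∈ interior (Icc a b), deriv f z ∈ Icc m L := fun z hz => by
    have := hd z (interior_subset hz)
    rwa [derivWithin_of_mem_nhds (mem_interior_iff_mem_nhds.1 hz)] at this
  exact ⟨(convex_Icc a b).mul_sub_le_image_sub_of_le_deriv hf.continuousOn
      (hf.mono interior_subset) (fun z hz => (hderiv z hz).1) x hx y hy hxy,
    (convex_Icc a b).image_sub_le_mul_sub_of_deriv_le hf.continuousOn
      (hf.mono interior_subset) (fun z hz => (hderiv z hz).2) x hx y hy hxy⟩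

theorem convexOn_Icc_of_derivWithin2_nonneg {f : ℝ → ℝ} {a b : ℝ} (hab : a < b)
    (hf : ContDiffOn ℝ 2 f (Icc a b))
    (h : ∀ x ∈ Icc a b, 0 ≤ derivWithin (derivWithin f (Icc a b)) (Icc a b) x) :
    ConvexOn ℝ (Icc a b) f := by
  have hu : UniqueDiffOn ℝ (Icc a b) := uniqueDiffOn_Icc hab
  have hf' : ContDiffOn ℝ 1 (derivWithin f (Icc a b)) (Icc a b) :=
    hf.derivWithin hu (by norm_num)
  exact convexOn_of_hasDerivWithinAt2_nonneg (convex_Icc a b) hf.continuousOn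
    (fun x hx => (hf.differentiableOn (by norm_num) x
      (interior_subset hx)).hasDerivWithinAt.mono interior_subset)
    (fun x hx => (hf'.differentiableOn (by norm_num) x
      (interior_subset hx)).hasDerivWithinAt.mono interior_subset)
    (fun x hx => h x (interior_subset hx))

theorem concaveOn_Icc_of_derivWithin2_nonpos {f : ℝ → ℝ} {a b : ℝ} (hab : a < b)
    (hf : ContDiffOn ℝ 2 f (Icc a b))
    (h : ∀ x ∈ Icc a b, derivWithin (derivWithin f (Icc a b)) (Icc a b) x ≤ 0) :
    ConcaveOn ℝ (Icc a b) f := by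
  have hu : UniqueDiffOn ℝ (Icc a b) := uniqueDiffOn_Icc hab
  have hf' : ContDiffOn ℝ 1 (derivWithin f (Icc a b)) (Icc a b) :=
    hf.derivWithin hu (by norm_num)
  exact concaveOn_of_hasDerivWithinAt2_nonpos (convex_Icc a b) hf.continuousOn
    (fun x hx => (hf.differentiableOn (by norm_num) x
      (interior_subset hx)).hasDerivWithinAt.mono interior_subset)
    (fun x hx => (hf'.differentiableOn (by norm_num) x
      (interior_subset hx)).hasDerivWithinAt.mono interior_subset)
    (fun x hx => h x (interior_subset hx))

/-- A `C²` function with negative second derivative is uniformly concave on compact intervals. -/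
theorem exists_midpoint_add_sq_le {g : ℝ → ℝ} (hg : ContDiff ℝ 2 g)
    (hneg : ∀ x, deriv (deriv g) x < 0) (a b : ℝ) :
    ∃ κ > 0, ∀ x ∈ Icc a b, ∀ y ∈ Icc a b,
      (g x + g y) / 2 + κ * (x - y) ^ 2 ≤ g ((x + y) / 2) := by
  rcases (Icc a b).eq_empty_or_nonempty with he | hne
  · exact ⟨1, one_pos, fun x hx => by simp [he] at hx⟩
  have hg1 : ContDiff ℝ 1 (deriv g) := by
    have : ContDiff ℝ (1 + 1) g := by norm_num; exact hg
    exact (contDiff_succ_iff_deriv.1 this).2.2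
  have hcont : Continuous (deriv (deriv g)) := hg1.continuous_deriv (by norm_num)
  obtain ⟨z, -, hz⟩ := isCompact_Icc.exists_isMaxOn hne hcont.continuousOn
  set m := -deriv (deriv g) z with hm
  have hm0 : 0 < m := by have := hneg z; linarith
  -- `m` is the minimum of `-g''` on the interval. Since `(x² + y²) / 2 - ((x + y) / 2)² = (x - y)²
  -- / 4`, the term `m / 2 * x ^ 2` yields the constant `m / 8`.
  have hconc : ConcaveOn ℝ (Icc a b) (fun x => g x + m / 2 * x ^ 2) := by
    refine concaveOn_of_hasDerivWithinAt2_nonpos (convex_Icc a b)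
      (f' := fun x => deriv g x + m * x) (f'' := fun x => deriv (deriv g) x + m) ?_ ?_ ?_ ?_
    · exact (hg.continuous.add (by fun_prop)).continuousOn
    · intro x _
      have h1 := (hg.differentiable (by norm_num) x).hasDerivAt
      have h2 := ((hasDerivAt_pow 2 x).const_mul (m / 2))
      refine ((h1.add h2).congr_deriv ?_).hasDerivWithinAt
      simp
      ring
    · intro x _
      have h1 := (hg1.differentiable (by norm_num) x).hasDerivAt
      have h2 := ((hasDerivAt_id x).const_mul m)
      refine ((h1.add h2).congr_deriv ?_).hasDerivWithinAt
      simp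
    · intro x hx
      have : deriv (deriv g) x ≤ deriv (deriv g) z := hz (interior_subset hx)
      linarith
  refine ⟨m / 8, by positivity, fun x hx y hy => ?_⟩
  have h := hconc.2 hx hy (by norm_num : (0 : ℝ) ≤ 1 / 2) (by norm_num : (0 : ℝ) ≤ 1 / 2)
      (by norm_num)
  simp only [smul_eq_mul] at h
  have e : 1 / 2 * x + 1 / 2 * y = (x + y) / 2 := by ring
  rw [e] at h
  nlinarith

namespace AnnotationModel

variable (M : AnnotationModel)

/-! ### Expectations -/

/-- The number of inspected samples that pass. -/
def passCount {n : ℕ} (a : Data n) : ℕ := (Finset.univ.filter fun i => a i = true).card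

theorem dataProb_eq {n : ℕ} (η : ℝ) (a : Data n) :
    M.dataProb η a = M.passProb η ^ passCount a * (1 - M.passProb η) ^ (n - passCount a) := by
  rw [dataProb, Finset.prod_ite, Finset.prod_const, Finset.prod_const, passCount]
  congr 2
  have h := Finset.card_filter_add_card_filter_not (s := (Finset.univ : Finset (Fin n)))
    (fun i => a i = true)
  rw [Finset.card_univ, Fintype.card_fin] at h
  omega

/-- Data are identified with the subset of passing samples, and subsets are grouped by cardinality.
-/
theorem expect_comp_passCount {n : ℕ} (η : ℝ) (g : ℕ → ℝ) :
    M.expect η (fun a : Data n => g (passCount a))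
      = ∑ j ∈ Finset.range (n + 1), binomialMass n (M.passProb η) j * g j := by
  set p := M.passProb η with hp
  have h := Finset.sum_powerset_apply_card (fun j => p ^ j * (1 - p) ^ (n - j) * g j)
    (x := (Finset.univ : Finset (Fin n)))
  rw [Finset.card_univ, Fintype.card_fin] at h
  have e : ∑ j ∈ Finset.range (n + 1), binomialMass n p j * g j
      = ∑ j ∈ Finset.range (n + 1), n.choose j • (p ^ j * (1 - p) ^ (n - j) * g j) := by
    refine Finset.sum_congr rfl fun j _ => ?_
    rw [binomialMass, nsmul_eq_mul]
    ring
  rw [e, ← h, expect]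
  refine Finset.sum_bij' (fun a _ => Finset.univ.filter fun i => a i = true)
    (fun s _ i => decide (i ∈ s)) ?_ ?_ ?_ ?_ ?_
  · intro a _; simp
  · intro s _; simp
  · intro a _; ext i; simp
  · intro s _; ext i; simp
  · intro a _
    rw [dataProb_eq]
    rfl

theorem sum_dataProb (n : ℕ) (η : ℝ) : ∑ a : Data n, M.dataProb η a = 1 := by
  have h := M.expect_comp_passCount (n := n) η fun _ => 1
  simp only [expect, mul_one] at h
  rw [h]
  exact binomialBelow_succ_self n _

variable {M}

theorem passProb_mem_Icc (hc : 0 < M.c) (hc1 : M.c ≤ 1) {η : ℝ} (hη : η ∈ Icc (0 : ℝ) 1) :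
    M.passProb η ∈ Icc (0 : ℝ) 1 := by
  have h0 : 0 ≤ M.c * η := mul_nonneg hc.le hη.1
  have h1 : M.c * η ≤ 1 := mul_le_one₀ hc1 hη.1 hη.2
  constructor <;> rw [passProb] <;> linarith

theorem dataProb_nonneg (hc : 0 < M.c) (hc1 : M.c ≤ 1) {η : ℝ} (hη : η ∈ Icc (0 : ℝ) 1) {n : ℕ}
    (a : Data n) : 0 ≤ M.dataProb η a := by
  have h := passProb_mem_Icc hc hc1 hη
  rw [dataProb_eq]
  have := h.1
  have : 0 ≤ 1 - M.passProb η := by linarith [h.2]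
  positivity

theorem le_expect (hc : 0 < M.c) (hc1 : M.c ≤ 1) {η : ℝ} (hη : η ∈ Icc (0 : ℝ) 1) {n : ℕ}
    {f : Data n → ℝ} {x : ℝ} (h : ∀ a, x ≤ f a) : x ≤ M.expect η f := by
  calc x = ∑ a : Data n, M.dataProb η a * x := by
        rw [← Finset.sum_mul, sum_dataProb, one_mul]
    _ ≤ _ := Finset.sum_le_sum fun a _ =>
        mul_le_mul_of_nonneg_left (h a) (dataProb_nonneg hc hc1 hη a)

theorem expAgent_eq {n : ℕ} (F : Contract n) (η : ℝ) :
    M.expAgent F η = M.expect η (fun a => M.money (F a)) - M.effort η := by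
  simp only [expAgent, expect, agentUtility, mul_sub, Finset.sum_sub_distrib]
  rw [← Finset.sum_mul, sum_dataProb, one_mul]

theorem expPrincipal_eq {n : ℕ} (F : Contract n) (η : ℝ) :
    M.expPrincipal F η = M.quality η - M.expect η F := by
  simp only [expPrincipal, expect, principalUtility, mul_add, mul_neg, Finset.sum_add_distrib,
    Finset.sum_neg_distrib]
  rw [← Finset.sum_mul, sum_dataProb, one_mul]
  ring

theorem expect_const {n : ℕ} (η x : ℝ) : M.expect η (fun _ : Data n => x) = x := by
  rw [expect, ← Finset.sum_mul, sum_dataProb, one_mul]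

theorem continuous_dataProb {n : ℕ} (a : Data n) : Continuous fun η => M.dataProb η a := by
  have : Continuous M.passProb := by unfold passProb; fun_prop
  simp only [dataProb_eq]
  fun_prop

/-! ### Threshold contracts -/

/-- The contract that pays `hi` if at least `k` samples pass, and `lo` otherwise. -/
def thresholdContract (n k : ℕ) (lo hi : ℝ) : Contract n :=
  fun a => if k ≤ passCount a then hi else lo

theorem thresholdContract_mem {n k : ℕ} {lo hi : ℝ} (hlo : lo ∈ Icc M.wageLo M.wageHi)
    (hhi : hi ∈ Icc M.wageLo M.wageHi) :
    thresholdContract n k lo hi ∈ M.binaryContracts n := by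
  refine ⟨fun a => ?_, fun a => decide (k ≤ passCount a), lo, hi - lo, ?_⟩
  · rw [thresholdContract]
    split_ifs <;> assumption
  · funext a
    simp [thresholdContract]

theorem expAgent_thresholdContract {n k : ℕ} (hk : k ≤ n) (lo hi η : ℝ) :
    M.expAgent (thresholdContract n k lo hi) η = M.money hi
      - (M.money hi - M.money lo) * binomialBelow n (M.passProb η) k - M.effort η := by
  have hfun : (fun a : Data n => M.money (thresholdContract n k lo hi a))
      = fun a => (fun j => if k ≤ j then M.money hi else M.money lo) (passCount a) := by
    funext a
    simp only [thresholdContract]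
    split_ifs <;> rfl
  rw [expAgent_eq, hfun,
    M.expect_comp_passCount η fun j => if k ≤ j then M.money hi else M.money lo,
    ← Finset.sum_range_add_sum_Ico _ (by omega : k ≤ n + 1)]
  have hone := binomialBelow_succ_self n (M.passProb η)
  rw [binomialBelow, ← Finset.sum_range_add_sum_Ico _ (by omega : k ≤ n + 1)] at hone
  have e1 : ∑ j ∈ Finset.range k, binomialMass n (M.passProb η) j *
      (if k ≤ j then M.money hi else M.money lo)
      = binomialBelow n (M.passProb η) k * M.money lo := by
    rw [binomialBelow, Finset.sum_mul]
    refine Finset.sum_congr rfl fun j hj => ?_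
    rw [if_neg (not_le.2 (Finset.mem_range.1 hj))]
  have e2 : ∑ j ∈ Finset.Ico k (n + 1), binomialMass n (M.passProb η) j *
      (if k ≤ j then M.money hi else M.money lo)
      = (1 - binomialBelow n (M.passProb η) k) * M.money hi := by
    have : 1 - binomialBelow n (M.passProb η) k
        = ∑ j ∈ Finset.Ico k (n + 1), binomialMass n (M.passProb η) j := by
      rw [binomialBelow]; linarith
    rw [this, Finset.sum_mul]
    refine Finset.sum_congr rfl fun j hj => ?_
    rw [if_pos (Finset.mem_Ico.1 hj).1]
  rw [e1, e2]
  ring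

/-! ### Consequences of the assumptions -/

theorem strictMono_money (h : M.AgentAssumption) : StrictMono M.money :=
  strictMono_of_deriv_pos h.2.1

theorem concaveOn_money (h : M.AgentAssumption) : ConcaveOn ℝ univ M.money := by
  have hd : Differentiable ℝ M.money := h.1.differentiable (by norm_num)
  have h1 : ContDiff ℝ (1 + 1) M.money := by norm_num; exact h.1
  have hd2 : Differentiable ℝ (deriv M.money) :=
    (contDiff_succ_iff_deriv.1 h1).2.2.differentiable (by norm_num)
  exact concaveOn_univ_of_deriv2_nonpos hd hd2 fun x => (h.2.2.1 x).le

theorem exists_money_bounds (h : M.AgentAssumption) (hne : M.wageLo ≤ M.wageHi) :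
    ∃ m > 0, ∃ L > 0, ∀ x ∈ Icc M.wageLo M.wageHi, ∀ y ∈ Icc M.wageLo M.wageHi, x ≤ y →
      M.money y - M.money x ∈ Icc (m * (y - x)) (L * (y - x)) := by
  have hcont : Continuous (deriv M.money) := h.1.continuous_deriv (by norm_num)
  obtain ⟨z, -, hz⟩ := isCompact_Icc.exists_isMinOn (nonempty_Icc.2 hne) hcont.continuousOn
  obtain ⟨z', -, hz'⟩ := isCompact_Icc.exists_isMaxOn (nonempty_Icc.2 hne) hcont.continuousOn
  have hd : Differentiable ℝ M.money := h.1.differentiable (by norm_num)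
  refine ⟨_, h.2.1 z, _, h.2.1 z', fun x hx y hy hxy => ⟨?_, ?_⟩⟩
  · exact (convex_Icc _ _).mul_sub_le_image_sub_of_le_deriv hd.continuous.continuousOn
      hd.differentiableOn (fun w hw => hz (interior_subset hw)) x hx y hy hxy
  · exact (convex_Icc _ _).image_sub_le_mul_sub_of_deriv_le hd.continuous.continuousOn
      hd.differentiableOn (fun w hw => hz' (interior_subset hw)) x hx y hy hxy

theorem exists_effort_bounds (h : M.AgentAssumption) :
    ∃ m > 0, ∃ L > 0, ∀ x ∈ Icc (0 : ℝ) 1, ∀ y ∈ Icc (0 : ℝ) 1, x ≤ y →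
      M.effort y - M.effort x ∈ Icc (m * (y - x)) (L * (y - x)) := by
  obtain ⟨-, -, -, hE, hpos, -⟩ := h
  have hcont := hE.continuousOn_derivWithin (uniqueDiffOn_Icc zero_lt_one) (by norm_num)
  have hne : (Icc (0 : ℝ) 1).Nonempty := nonempty_Icc.2 zero_le_one
  obtain ⟨z, hzm, hz⟩ := isCompact_Icc.exists_isMinOn hne hcont
  obtain ⟨z', hzm', hz'⟩ := isCompact_Icc.exists_isMaxOn hne hcont
  exact ⟨_, hpos z hzm, _, hpos z' hzm', fun x hx y hy hxy =>
    sub_mem_Icc_of_derivWithin_mem_Icc (hE.differentiableOn (by norm_num))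
      (fun w hw => ⟨hz hw, hz' hw⟩) hx hy hxy⟩

theorem exists_quality_bounds (h : M.PrincipalAssumption) :
    ∃ L ≥ 0, ∀ x ∈ Icc (0 : ℝ) 1, ∀ y ∈ Icc (0 : ℝ) 1, x ≤ y →
      M.quality y - M.quality x ∈ Icc 0 (L * (y - x)) := by
  obtain ⟨hμ, hpos, -⟩ := h
  have hcont := hμ.continuousOn_derivWithin (uniqueDiffOn_Icc zero_lt_one) (by norm_num)
  have hne : (Icc (0 : ℝ) 1).Nonempty := nonempty_Icc.2 zero_le_one
  obtain ⟨z', hzm', hz'⟩ := isCompact_Icc.exists_isMaxOn hne hcont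
  refine ⟨_, hpos z' hzm', fun x hx y hy hxy => ?_⟩
  have := sub_mem_Icc_of_derivWithin_mem_Icc (hμ.differentiableOn (by norm_num))
      (fun w hw => ⟨hpos w hw, hz' hw⟩) hx hy hxy
  rwa [zero_mul] at this

/-- Every effort is exactly compensated by some wage strictly inside the wage range. -/
theorem exists_wage (hagent : M.AgentAssumption) (hwage : M.WageAssumption) {η : ℝ}
    (hη : η ∈ Icc (0 : ℝ) 1) :
    ∃ w ∈ Ioo M.wageLo M.wageHi, M.money w = M.effort η + M.leisure := by
  have hmono := strictMono_money hagent
  have hmem := hwage (mem_image_of_mem _ hη)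
  obtain ⟨w, -, hw⟩ := interior_subset hmem
  replace hw : M.money w = M.effort η + M.leisure := hw
  have hsub : M.money '' Icc M.wageLo M.wageHi ⊆ Icc (M.money M.wageLo) (M.money M.wageHi) := by
    rintro _ ⟨x, hx, rfl⟩
    exact ⟨hmono.monotone hx.1, hmono.monotone hx.2⟩
  have h2 := interior_mono hsub hmem
  rw [interior_Icc] at h2
  change M.effort η + M.leisure ∈ Ioo _ _ at h2
  rw [← hw] at h2
  exact ⟨w, ⟨hmono.lt_iff_lt.1 h2.1, hmono.lt_iff_lt.1 h2.2⟩, hw⟩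

/-- Jensen's inequality: an individually rational contract costs at least the wage that exactly
compensates the effort. -/
theorem expPrincipal_le (hc : 0 < M.c) (hc1 : M.c ≤ 1) (hagent : M.AgentAssumption) {n : ℕ}
    {F : Contract n} {η w : ℝ} (hη : η ∈ Icc (0 : ℝ) 1) (hIR : M.IsIR F η)
    (hw : M.money w = M.effort η + M.leisure) :
    M.expPrincipal F η ≤ M.quality η - w := by
  have hJ := (concaveOn_money hagent).le_map_sum (t := Finset.univ) (w := M.dataProb η) (p := F)
    (fun a _ => dataProb_nonneg hc hc1 hη a) (M.sum_dataProb n η) (fun a _ => mem_univ _)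
  simp only [smul_eq_mul] at hJ
  rw [IsIR, expAgent_eq, expect] at hIR
  have h : w ≤ ∑ a, M.dataProb η a * F a := by
    rw [← (strictMono_money hagent).le_iff_le]
    linarith
  rw [expPrincipal_eq, expect]
  linarith

/-- The loss of the principal is at least quadratic in the distance to the first-best effort. -/
theorem exists_quadratic_loss (hc : 0 < M.c) (hc1 : M.c ≤ 1) (hagent : M.AgentAssumption)
    (hprincipal : M.PrincipalAssumption) (hwage : M.WageAssumption) {ηs : ℝ}
    (hfirst : M.IsFirstBestEffort ηs) :
    ∃ κ > 0, ∀ ws, M.money ws = M.effort ηs + M.leisure →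
      ∀ η ∈ Icc (0 : ℝ) 1, ∀ w, M.money w = M.effort η + M.leisure →
      M.quality η - w ≤ M.quality ηs - ws - κ * (η - ηs) ^ 2 := by
  obtain ⟨m, F₀, ⟨-, hηs, hIR⟩, hopt⟩ := hfirst
  have hmono := strictMono_money hagent
  obtain ⟨w₀, hw₀, -⟩ := exists_wage hagent hwage hηs
  have hlohi : M.wageLo ≤ M.wageHi := (hw₀.1.trans hw₀.2).le
  obtain ⟨κ, hκ, hmid⟩ := exists_midpoint_add_sq_le hagent.1 hagent.2.2.1 M.wageLo M.wageHi
  obtain ⟨_, _, L, hL, hmon⟩ := exists_money_bounds hagent hlohi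
  obtain ⟨e, he, _, _, heff⟩ := exists_effort_bounds hagent
  have hEconv := convexOn_Icc_of_derivWithin2_nonneg zero_lt_one hagent.2.2.2.1 hagent.2.2.2.2.2
  have hμconc := concaveOn_Icc_of_derivWithin2_nonpos zero_lt_one hprincipal.1 hprincipal.2.2
  have hwmem : ∀ η ∈ Icc (0 : ℝ) 1, ∀ w, M.money w = M.effort η + M.leisure →
      w ∈ Icc M.wageLo M.wageHi := by
    intro η hη w hw
    obtain ⟨w', hw', h⟩ := exists_wage hagent hwage hη
    rw [hmono.injective (hw.trans h.symm)]
    exact Ioo_subset_Icc_self hw'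
  have hsq : ∀ η₁ ∈ Icc (0 : ℝ) 1, ∀ η₂ ∈ Icc (0 : ℝ) 1, ∀ w₁ w₂,
      M.money w₁ = M.effort η₁ + M.leisure → M.money w₂ = M.effort η₂ + M.leisure → η₁ ≤ η₂ →
      (e / L) ^ 2 * (η₁ - η₂) ^ 2 ≤ (w₁ - w₂) ^ 2 := by
    intro η₁ h₁ η₂ h₂ w₁ w₂ hw₁ hw₂ hle
    have hE := (heff η₁ h₁ η₂ h₂ hle).1
    have hww : w₁ ≤ w₂ := by
      rw [← hmono.le_iff_le]
      have : 0 ≤ e * (η₂ - η₁) := mul_nonneg he.le (by linarith)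
      linarith
    have hG := (hmon w₁ (hwmem η₁ h₁ w₁ hw₁) w₂ (hwmem η₂ h₂ w₂ hw₂) hww).2
    have hlin : e / L * (η₂ - η₁) ≤ w₂ - w₁ := by
      rw [div_mul_eq_mul_div, div_le_iff₀ hL]
      linarith
    have h0 : 0 ≤ e / L * (η₂ - η₁) := mul_nonneg (by positivity) (by linarith)
    have := pow_le_pow_left₀ h0 hlin 2
    linarith
  -- No first-order condition is used: the midpoint of `η` and `ηs` beats the average of the two
  -- values by `κ / L * (w - ws) ^ 2` but cannot beat the value at `ηs`, whence the factor `2`. The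
  -- factor `(e / L) ^ 2` turns wage distance into effort distance.
  refine ⟨2 * (κ / L * (e / L) ^ 2), by positivity, fun ws hws η hη w hw => ?_⟩
  set ηm := (η + ηs) / 2 with hηm
  have hηm_mem : ηm ∈ Icc (0 : ℝ) 1 := ⟨by linarith [hη.1, hηs.1], by linarith [hη.2, hηs.2]⟩
  obtain ⟨wm, hwm, hGm⟩ := exists_wage hagent hwage hηm_mem
  have hwI := hwmem η hη w hw
  have hwsI := hwmem ηs hηs ws hws
  have hcomb : (1 / 2 : ℝ) • η + (1 / 2 : ℝ) • ηs = ηm := by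
    simp only [smul_eq_mul, hηm]; ring
  have hEm : M.effort ηm ≤ (M.effort η + M.effort ηs) / 2 := by
    have := hEconv.2 hη hηs (by norm_num : (0 : ℝ) ≤ 1 / 2) (by norm_num : (0 : ℝ) ≤ 1 / 2)
      (by norm_num)
    rw [hcomb, smul_eq_mul, smul_eq_mul] at this
    linarith
  have hμm : (M.quality η + M.quality ηs) / 2 ≤ M.quality ηm := by
    have := hμconc.2 hη hηs (by norm_num : (0 : ℝ) ≤ 1 / 2) (by norm_num : (0 : ℝ) ≤ 1 / 2)
      (by norm_num)
    rw [hcomb, smul_eq_mul, smul_eq_mul] at this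
    linarith
  have hGmid := hmid w hwI ws hwsI
  have hnn : 0 ≤ κ * (w - ws) ^ 2 := by positivity
  have hle : wm ≤ (w + ws) / 2 := by
    rw [← hmono.le_iff_le]
    linarith
  have hwidth := (hmon wm (Ioo_subset_Icc_self hwm) ((w + ws) / 2)
    ⟨by linarith [hwI.1, hwsI.1], by linarith [hwI.2, hwsI.2]⟩ hle).2
  have hwm_le : wm ≤ (w + ws) / 2 - κ / L * (w - ws) ^ 2 := by
    have : κ * (w - ws) ^ 2 ≤ L * ((w + ws) / 2 - wm) := by linarith
    have h2 : κ / L * (w - ws) ^ 2 ≤ (w + ws) / 2 - wm := by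
      rw [div_mul_eq_mul_div, div_le_iff₀ hL]
      linarith
    linarith
  have hdist : (e / L) ^ 2 * (η - ηs) ^ 2 ≤ (w - ws) ^ 2 := by
    rcases le_total η ηs with h | h
    · exact hsq η hη ηs hηs w ws hw hws h
    · have := hsq ηs hηs η hη ws w hws hw h
      linarith [sq_nonneg (w - ws)]
  -- the midpoint effort with its compensating wage is feasible for the first-best program
  have hfb : M.quality ηm - wm ≤ M.quality ηs - ws := by
    have h1 := hopt (fun _ => wm) (fun _ => Ioo_subset_Icc_self hwm) ηm hηm_mem
      (by rw [IsIR, expAgent_eq, expect_const, hGm]; linarith)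
    rw [expPrincipal_eq, expect_const] at h1
    exact h1.trans (expPrincipal_le hc hc1 hagent hηs hIR hws)
  have hfin : κ / L * ((e / L) ^ 2 * (η - ηs) ^ 2) ≤ κ / L * (w - ws) ^ 2 :=
    mul_le_mul_of_nonneg_left hdist (by positivity)
  linarith

/-! ### Existence of optimal contracts -/

theorem continuousOn_expAgent (hagent : M.AgentAssumption) (n : ℕ) :
    ContinuousOn (fun x : Contract n × ℝ => M.expAgent x.1 x.2) (univ ×ˢ Icc 0 1) := by
  have hG : Continuous M.money := hagent.1.continuous
  have hE : ContinuousOn (fun x : Contract n × ℝ => M.effort x.2) (univ ×ˢ Icc 0 1) :=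
    hagent.2.2.2.1.continuousOn.comp continuousOn_snd fun x hx => hx.2
  simp only [expAgent_eq, expect]
  refine ContinuousOn.sub (Continuous.continuousOn ?_) hE
  refine continuous_finsetSum _ fun a _ => ?_
  exact ((continuous_dataProb a).comp continuous_snd).mul (hG.comp (by fun_prop))

theorem continuousOn_expPrincipal (hprincipal : M.PrincipalAssumption) (n : ℕ) :
    ContinuousOn (fun x : Contract n × ℝ => M.expPrincipal x.1 x.2) (univ ×ˢ Icc 0 1) := by
  have hμ : ContinuousOn (fun x : Contract n × ℝ => M.quality x.2) (univ ×ˢ Icc 0 1) :=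
    hprincipal.1.continuousOn.comp continuousOn_snd fun x hx => hx.2
  simp only [expPrincipal_eq, expect]
  refine hμ.sub (Continuous.continuousOn ?_)
  refine continuous_finsetSum _ fun a _ => ?_
  exact ((continuous_dataProb a).comp continuous_snd).mul (by fun_prop)

theorem exists_isIC (hagent : M.AgentAssumption) {n : ℕ} (F : Contract n) :
    ∃ η, M.IsIC F η := by
  have hcont : ContinuousOn (M.expAgent F) (Icc 0 1) :=
    (continuousOn_expAgent hagent n).comp (f := fun η => (F, η)) (by fun_prop)
      fun η hη => ⟨mem_univ _, hη⟩
  obtain ⟨η, hη, hmax⟩ := isCompact_Icc.exists_isMaxOn (nonempty_Icc.2 zero_le_one) hcont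
  exact ⟨η, hη, hmax⟩

/-- For a fixed test, the existence of a salary and a bonus means that the wage depends only on the
test result, a closed condition. There are finitely many tests. -/
theorem isClosed_binaryContracts (n : ℕ) : IsClosed (M.binaryContracts n) := by
  have hset : M.binaryContracts n = M.contracts n ∩
      ⋃ Ψ : Data n → Bool, {F | ∀ a b, Ψ a = Ψ b → F a = F b} := by
    ext F
    simp only [binaryContracts, mem_ofPred_eq, mem_inter_iff, mem_iUnion]
    refine and_congr_right fun _ => exists_congr fun Ψ => ⟨?_, fun h => ?_⟩
    · rintro ⟨w, wb, rfl⟩ a b hab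
      simp only [hab]
    · have hval : ∀ v, ∃ x, ∀ a, Ψ a = v → F a = x := by
        intro v
        by_cases hv : ∃ a, Ψ a = v
        · obtain ⟨a, ha⟩ := hv
          exact ⟨F a, fun b hb => h b a (hb.trans ha.symm)⟩
        · exact ⟨0, fun a ha => (hv ⟨a, ha⟩).elim⟩
      obtain ⟨x, hx⟩ := hval true
      obtain ⟨w, hw⟩ := hval false
      refine ⟨w, x - w, ?_⟩
      funext a
      cases ha : Ψ a
      · simpa using hw a ha
      · simpa using hx a ha
  rw [hset]
  refine IsClosed.inter ?_ (isClosed_iUnion_of_finite fun Ψ => ?_)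
  · have : M.contracts n = Set.pi univ fun _ => Icc M.wageLo M.wageHi := by
      ext F; simp only [contracts, mem_ofPred_eq, mem_univ_pi]
    rw [this]
    exact isClosed_set_pi fun _ _ => isClosed_Icc
  · simp only [ofPred_forall]
    exact isClosed_iInter fun a => isClosed_iInter fun b => isClosed_iInter fun _ =>
      isClosed_eq (continuous_apply a) (continuous_apply b)

/-- The feasible pairs of the second-best program over binary contracts. -/
def feasibleBinary (M : AnnotationModel) (n : ℕ) : Set (Contract n × ℝ) :=
  {x | x.1 ∈ M.binaryContracts n ∧ M.IsIR x.1 x.2 ∧ M.IsIC x.1 x.2}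

theorem feasibleBinary_subset (n : ℕ) : M.feasibleBinary n ⊆ univ ×ˢ Icc 0 1 :=
  fun _ hx => ⟨mem_univ _, hx.2.2.1⟩

theorem isCompact_feasibleBinary (hagent : M.AgentAssumption) (n : ℕ) :
    IsCompact (M.feasibleBinary n) := by
  have hBc : IsCompact ((Set.pi univ fun _ : Data n => Icc M.wageLo M.wageHi) ×ˢ
      Icc (0 : ℝ) 1) := (isCompact_univ_pi fun _ => isCompact_Icc).prod isCompact_Icc
  have hPc : IsClosed ((univ : Set (Contract n)) ×ˢ Icc (0 : ℝ) 1) :=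
    isClosed_univ.prod isClosed_Icc
  have hcont := continuousOn_expAgent hagent n
  -- Incentive compatibility is an intersection of closed conditions, one per deviation `η'`. Each
  -- keeps the constraint to `[0, 1]`, where alone the effort function is known to be continuous.
  have hset : M.feasibleBinary n =
      ({x | x ∈ univ ×ˢ Icc 0 1 ∧ M.leisure ≤ M.expAgent x.1 x.2} ∩
      (Prod.fst ⁻¹' M.binaryContracts n)) ∩
      ⋂ η' ∈ Icc (0 : ℝ) 1, {x | x ∈ univ ×ˢ Icc 0 1 ∧
        M.expAgent x.1 η' ≤ M.expAgent x.1 x.2} := by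
    refine Subset.antisymm (fun x hx => ⟨⟨⟨feasibleBinary_subset n hx, hx.2.1⟩, hx.1⟩,
      mem_iInter₂.2 fun η' hη' => ⟨feasibleBinary_subset n hx, hx.2.2.2 hη'⟩⟩) ?_
    rintro x ⟨⟨⟨hx, hIR⟩, hF⟩, h⟩
    exact ⟨hF, hIR, hx.2, fun η' hη' => (mem_iInter₂.1 h η' hη').2⟩
  refine hBc.of_isClosed_subset ?_ fun x hx => ⟨fun a _ => hx.1.1 a, hx.2.2.1⟩
  rw [hset]
  refine ((hPc.isClosed_le continuousOn_const hcont).inter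
    ((isClosed_binaryContracts n).preimage continuous_fst)).inter
    (isClosed_biInter fun η' hη' => hPc.isClosed_le ?_ hcont)
  exact hcont.comp (f := fun x : Contract n × ℝ => (x.1, η'))
    (continuous_fst.prodMk continuous_const).continuousOn fun x _ => ⟨mem_univ _, hη'⟩

/-- A constant wage that exactly compensates zero effort induces zero effort. -/
theorem feasibleBinary_nonempty (hagent : M.AgentAssumption) (hwage : M.WageAssumption) (n : ℕ) :
    (M.feasibleBinary n).Nonempty := by
  have h0 : (0 : ℝ) ∈ Icc (0 : ℝ) 1 := ⟨le_rfl, zero_le_one⟩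
  obtain ⟨w, hw, hGw⟩ := exists_wage hagent hwage h0
  obtain ⟨e, he, _, _, heff⟩ := exists_effort_bounds hagent
  have hU : ∀ η, M.expAgent (fun _ : Data n => w) η = M.effort 0 + M.leisure - M.effort η :=
    fun η => by rw [expAgent_eq, expect_const, hGw]
  refine ⟨(fun _ => w, 0), ⟨fun _ => Ioo_subset_Icc_self hw, fun _ => true, w, 0, by simp⟩,
    ?_, h0, fun η' hη' => ?_⟩
  · change M.leisure ≤ M.expAgent (fun _ : Data n => w) 0
    rw [hU]
    linarith
  · change M.expAgent (fun _ : Data n => w) η' ≤ M.expAgent (fun _ : Data n => w) 0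
    have := (heff 0 h0 η' hη' hη'.1).1
    have h' : 0 ≤ e * (η' - 0) := mul_nonneg he.le (by linarith [hη'.1])
    rw [hU, hU]
    linarith

theorem exists_isBinarySecondBestEffort (hagent : M.AgentAssumption)
    (hprincipal : M.PrincipalAssumption) (hwage : M.WageAssumption) (n : ℕ) :
    ∃ η, M.IsBinarySecondBestEffort n η := by
  obtain ⟨⟨F, η⟩, hmem, hmax⟩ := (isCompact_feasibleBinary hagent n).exists_isMaxOn
    (feasibleBinary_nonempty hagent hwage n)
    ((continuousOn_expPrincipal hprincipal n).mono (feasibleBinary_subset n))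
  exact ⟨η, F, hmem, fun F' hF' η' hIR hIC =>
    isMaxOn_iff.1 hmax (F', η') ⟨hF', hIR, hIC⟩⟩

/-! ### Near-optimal threshold contracts -/

/-- The penalty for failing is the lowest wage, and the wage for passing exceeds `ws` by `O(r)` to
offset the risk of failing at `ηs`. -/
theorem exists_binaryContract_near_optimal (hc : 0 < M.c) (hc1 : M.c ≤ 1)
    (hagent : M.AgentAssumption) (hprincipal : M.PrincipalAssumption) (hwage : M.WageAssumption)
    {ηs ws : ℝ} (hηs : ηs ∈ Ioo (0 : ℝ) 1) (hws : M.money ws = M.effort ηs + M.leisure) :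
    ∃ C, ∀ᶠ n : ℕ in atTop, ∃ F ∈ M.binaryContracts n, ∃ η, M.IsIR F η ∧ M.IsIC F η ∧
      M.quality ηs - ws - C * (1 / Real.sqrt (n * Real.log n)) ≤ M.expPrincipal F η := by
  have hmono := strictMono_money hagent
  have hηsI := Ioo_subset_Icc_self hηs
  have h0 : (0 : ℝ) ∈ Icc (0 : ℝ) 1 := ⟨le_rfl, zero_le_one⟩
  obtain ⟨w₁, hwsI, hw₁⟩ := exists_wage hagent hwage hηsI
  rw [← hmono.injective (hws.trans hw₁.symm)] at hwsI
  have hlohi : M.wageLo ≤ M.wageHi := (hwsI.1.trans hwsI.2).le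
  obtain ⟨w₀, hw₀I, hw₀⟩ := exists_wage hagent hwage h0
  obtain ⟨m, hm, _, _, hmon⟩ := exists_money_bounds hagent hlohi
  obtain ⟨_, _, LE, hLE, heff⟩ := exists_effort_bounds hagent
  obtain ⟨Lμ, hLμ, hqual⟩ := exists_quality_bounds hprincipal
  set p := M.passProb ηs with hp
  have hp_half : p - 1 / 2 = M.c * ηs / 2 := by rw [hp, passProb]; ring
  have hcη : M.c * ηs < 1 := mul_lt_one_of_nonneg_of_lt_one_right hc1 hηs.1.le hηs.2
  have hcη0 : 0 < M.c * ηs := mul_pos hc hηs.1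
  -- the smallest possible spread of the two utility levels
  set Δ₀ := M.money ws - M.money M.wageLo with hΔ₀
  have hΔ₀0 : 0 < Δ₀ := sub_pos.2 (hmono hwsI.1)
  set δ := M.money w₀ - M.money M.wageLo with hδ
  have hδ0 : 0 < δ := sub_pos.2 (hmono hw₀I.1)
  set D := M.money M.wageHi - M.money M.wageLo with hD
  have hD0 : 0 ≤ D := sub_nonneg.2 (hmono.monotone hlohi)
  -- `δ` is the amount by which the lowest wage fails to compensate even zero effort. This `ε` makes
  -- almost certain failure unattractive, and `A` below makes the added risk outweigh the effort
  -- saved.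
  set ε := δ / (4 * Δ₀) with hε
  have hε0 : 0 < ε := by positivity
  have hεΔ : Δ₀ * ε = δ / 4 := by rw [hε]; field_simp
  set A := 1 + 2 * LE / M.c / Δ₀ with hA
  have hA1 : 1 < A := by
    have : 0 < 2 * LE / M.c / Δ₀ := by positivity
    linarith
  have hAΔ : Δ₀ * (A - 1) = 2 * LE / M.c := by rw [hA]; field_simp; ring
  obtain ⟨C, hC, hev⟩ := exists_threshold (p := p) (A := A) (ε := ε) (by linarith)
    (by rw [hp, passProb]; linarith) (by linarith) hε0
  set B := D / m with hB
  have hBm : m * B = D := by rw [hB]; field_simp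
  have hB0 : 0 ≤ B := by positivity
  have hsmall : ∀ a : ℝ, 0 < a → ∀ᶠ n : ℕ in atTop, 1 / Real.sqrt (n * Real.log n) < a :=
    fun a ha => tendsto_one_div_sqrt_mul_log.eventually (gt_mem_nhds ha)
  -- `B * r` is the wage premium; the other term is the quality lost to an effort shortfall of at
  -- most `2 * C / M.c * r`.
  refine ⟨B + Lμ * (2 * C / M.c), ?_⟩
  filter_upwards [hev, hsmall ε hε0,
    hsmall ((M.wageHi - ws) / (B + 1)) (div_pos (by linarith [hwsI.2]) (by linarith))]
    with n hn hrε hrB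
  set r := 1 / Real.sqrt (n * Real.log n) with hr
  have hr0 : 0 ≤ r := by positivity
  obtain ⟨k, hkn, hqk, hgrow⟩ := hn
  set hi := ws + B * r with hhi
  have hhi_lo : ws ≤ hi := by
    have : 0 ≤ B * r := by positivity
    linarith
  have hhi_hi : hi ≤ M.wageHi := by
    rw [lt_div_iff₀ (by linarith)] at hrB
    linarith
  have hloI : M.wageLo ∈ Icc M.wageLo M.wageHi := ⟨le_rfl, hlohi⟩
  have hhiI : hi ∈ Icc M.wageLo M.wageHi := ⟨by linarith [hwsI.1], hhi_hi⟩
  set F : Contract n := thresholdContract n k M.wageLo hi with hF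
  set Δ := M.money hi - M.money M.wageLo with hΔ
  have hΔΔ₀ : Δ₀ ≤ Δ := sub_le_sub_right (hmono.monotone hhi_lo) _
  have hΔD : Δ ≤ D := sub_le_sub_right (hmono.monotone hhi_hi) _
  have hU : ∀ η, M.expAgent F η
      = M.money hi - Δ * binomialBelow n (M.passProb η) k - M.effort η :=
    fun η => expAgent_thresholdContract hkn _ _ _
  obtain ⟨η, hIC⟩ := exists_isIC hagent F
  have hηI := hIC.1
  have hopt : M.expAgent F ηs ≤ M.expAgent F η := hIC.2 hηsI
  rw [hU ηs, ← hp] at hopt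
  have hΔr : Δ * binomialBelow n p k ≤ Δ * r := by
    have : 0 ≤ Δ := by linarith
    gcongr
  -- The utility at `ηs` bounds that at the optimal `η` from below, and `m * B = D` makes the
  -- premium cover the expected penalty `Δ * r`.
  have hIR : M.IsIR F η := by
    have h1 := (hmon ws (Ioo_subset_Icc_self hwsI) hi hhiI hhi_lo).1
    have h2 : m * (hi - ws) = D * r := by rw [hhi, ← hBm]; ring
    have h3 : Δ * r ≤ D * r := by gcongr
    rw [IsIR]
    linarith
  -- the agent's effort cannot be much below the first-best effort
  have hηlow : ηs - η ≤ 2 * C / M.c * r := by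
    by_contra! hlt
    set d := M.c * (ηs - η) / 2 with hd
    have hCd : C * r ≤ d := by
      rw [div_mul_eq_mul_div, div_lt_iff₀ hc] at hlt
      linarith
    have hdη : ηs - η = 2 * d / M.c := by rw [hd]; field_simp
    have hd0 : 0 ≤ d := le_trans (by positivity) hCd
    have hle : η ≤ ηs := by
      have : 0 ≤ 2 * C / M.c * r := by positivity
      linarith
    have hpd : M.passProb η = p - d := by rw [hp, hd, passProb, passProb]; ring
    have hdp : d ≤ p - 1 / 2 := by
      have : 0 ≤ M.c * η := mul_nonneg hc.le hηI.1
      linarith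
    rw [hU η, hpd] at hopt
    have hEdiff : M.effort ηs - M.effort η ≤ Δ₀ * (A - 1) * d := by
      have h1 := (heff η hηI ηs hηsI hle).2
      rw [hAΔ]
      have : LE * (ηs - η) = 2 * LE / M.c * d := by rw [hdη]; ring
      linarith
    have hEmono : M.effort 0 ≤ M.effort η := by
      obtain ⟨e, he, _, _, heff'⟩ := exists_effort_bounds hagent
      have h1 := (heff' 0 h0 η hηI hηI.1).1
      have : 0 ≤ e * (η - 0) := mul_nonneg he.le (by linarith [hηI.1])
      linarith
    have hdpos : 0 < d := by
      rcases hd0.lt_or_eq with h | h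
      · exact h
      · rw [← h] at hdη
        have : 0 ≤ 2 * C / M.c * r := by positivity
        simp at hdη
        linarith
    -- In the first case optimality of `η` would force `Δ₀ * d ≤ 0`; in the second, `δ ≤ Δ₀ * (ε +
    -- r) ≤ δ / 2`.
    rcases hgrow d hCd hdp with h | h
    · have h1 : Δ * (A * (r + d)) ≤ Δ * binomialBelow n (p - d) k := by
        have : 0 ≤ Δ := by linarith
        gcongr
      have h2 : Δ₀ * ((A - 1) * r + A * d) ≤ Δ * ((A - 1) * r + A * d) := by
        have : 0 ≤ A - 1 := by linarith
        have : 0 ≤ A := by linarith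
        gcongr
      have h3 : 0 ≤ Δ₀ * ((A - 1) * r) := by
        have : 0 ≤ A - 1 := by linarith
        positivity
      have h4 : 0 < Δ₀ * d := by positivity
      linarith
    · have h1 : Δ * (1 - ε) ≤ Δ * binomialBelow n (p - d) k := by
        have : 0 ≤ Δ := by linarith
        gcongr
      have h2 : Δ₀ * (1 - ε - r) ≤ Δ * (1 - ε - r) := by
        have hε1 : ε ≤ 1 / 4 := by
          rw [hε, div_le_iff₀ (by positivity)]
          have : M.money w₀ ≤ M.money ws := by
            rw [hw₀, hws]
            obtain ⟨e, he, _, _, heff'⟩ := exists_effort_bounds hagent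
            have h1 := (heff' 0 h0 ηs hηsI hηs.1.le).1
            have : 0 ≤ e * (ηs - 0) := mul_nonneg he.le (by linarith [hηs.1])
            linarith
          linarith
        have : 0 ≤ 1 - ε - r := by linarith
        gcongr
      have h3 : Δ₀ * r ≤ Δ₀ * ε := by gcongr
      linarith
  refine ⟨F, thresholdContract_mem hloI hhiI, η, hIR, hIC, ?_⟩
  -- Every payment is at most `hi`, and effort above `ηs` does not lower quality, so only a
  -- shortfall of effort has to be controlled.
  have hpay : M.quality η - hi ≤ M.expPrincipal F η := by
    refine le_expect hc hc1 hηI fun a => ?_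
    have : F a ≤ hi := by
      rw [hF, thresholdContract]
      split_ifs
      · exact le_rfl
      · exact hhiI.1
    rw [principalUtility]
    linarith
  have hq : M.quality ηs - Lμ * (2 * C / M.c * r) ≤ M.quality η := by
    rcases le_total η ηs with h | h
    · have h1 := (hqual η hηI ηs hηsI h).2
      have h2 : Lμ * (ηs - η) ≤ Lμ * (2 * C / M.c * r) := by gcongr
      linarith
    · have h1 := (hqual ηs hηsI η hηI h).1
      have h2 : 0 ≤ Lμ * (2 * C / M.c * r) := by positivity
      linarith
  rw [hhi] at hpay
  linarith

end AnnotationModel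

/-! ### The convergence rate. -/

theorem mainTheorem9 (M : AnnotationModel) (hc : 0 < M.c) (hc1 : M.c ≤ 1)
    (hagent : M.AgentAssumption) (hprincipal : M.PrincipalAssumption) (hwage : M.WageAssumption)
    (ηstar : ℝ) (hfirst : M.IsFirstBestEffort ηstar) (hinterior : ηstar ∈ Ioo (0 : ℝ) 1) :
    (∀ n : ℕ, ∃ η : ℝ, M.IsBinarySecondBestEffort n η) ∧
    ∀ η : ℕ → ℝ, (∀ n, M.IsBinarySecondBestEffort n (η n)) →
      ((fun n => (η n - ηstar) ^ 2) =O[atTop]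
        fun n : ℕ => 1 / Real.sqrt ((n : ℝ) * Real.log (n : ℝ))) ∧
      Tendsto η atTop (𝓝 ηstar) := by
  refine ⟨M.exists_isBinarySecondBestEffort hagent hprincipal hwage, fun η hη => ?_⟩
  obtain ⟨ws, -, hws⟩ :=
    AnnotationModel.exists_wage hagent hwage (Ioo_subset_Icc_self hinterior)
  obtain ⟨κ, hκ, hloss⟩ :=
    AnnotationModel.exists_quadratic_loss hc hc1 hagent hprincipal hwage hfirst
  obtain ⟨C, hC⟩ := AnnotationModel.exists_binaryContract_near_optimal hc hc1 hagent hprincipal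
    hwage hinterior hws
  have hO : (fun n => (η n - ηstar) ^ 2) =O[atTop]
      fun n : ℕ => 1 / Real.sqrt ((n : ℝ) * Real.log (n : ℝ)) := by
    refine IsBigO.of_bound (C / κ) ?_
    filter_upwards [hC] with n hn
    obtain ⟨F', hF', η', hIR', hIC', hval⟩ := hn
    obtain ⟨F, ⟨-, hIR, hIC⟩, hopt⟩ := hη n
    obtain ⟨w, -, hw⟩ := AnnotationModel.exists_wage hagent hwage hIC.1
    have h1 := hopt F' hF' η' hIR' hIC'
    have h2 := AnnotationModel.expPrincipal_le hc hc1 hagent hIC.1 hIR hw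
    have h3 := hloss ws hws (η n) hIC.1 w hw
    rw [Real.norm_of_nonneg (sq_nonneg _), Real.norm_of_nonneg (by positivity),
      div_mul_eq_mul_div, le_div_iff₀ hκ]
    linarith
  refine ⟨hO, ?_⟩
  have hsq := hO.trans_tendsto tendsto_one_div_sqrt_mul_log
  have habs := (Real.continuous_sqrt.tendsto 0).comp hsq
  rw [Real.sqrt_zero] at habs
  rw [tendsto_iff_norm_sub_tendsto_zero]
  refine habs.congr fun n => ?_
  rw [Function.comp_apply, Real.sqrt_sq_eq_abs, Real.norm_eq_abs]
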